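/- Let $N \ge 1$ be an integer. For a function $f$ on the upper half-plane $\mathbb H$ and $\gamma=\begin{pmatrix} a & b \\ c & d\end{pmatrix}\in \mathrm{SL}_2(\mathbb R)$ put $(f|_2\gamma)(z)=(cz+d)^{-2}f\big(\tfrac{az+b}{cz+d}\big)$, and let $W_N=\begin{pmatrix} 0 & -1/\sqrt N\\ \sqrt N & 0\end{pmatrix}$. Let $f$ be a weakly holomorphic cusp form of weight $2$ for $\Gamma_0(N)$, that is, a holomorphic function on $\mathbb H$ with $f|_2\gamma=f$ for all $\gamma\in\Gamma_0(N)$, which is meromorphic at all cusps and whose Fourier expansion at $\infty$ has no constant term: $$f(z)=\sum_{n\ge -n_0,\ n\ne 0} a_f(n)e^{2\pi i n z}$$ (no condition is needed on the constant terms at the other cusps). Suppose that $f|_2W_N=f$. For $s\in\mathbb C$ let $\varphi_s(t)=N^{s/2}t^{s-1}$ for $t\ge 1/\sqrt N$ and $\varphi_s(t)=0$ for $t<1/\sqrt N$, and define $$\Lambda(f,s)=\sum_{n\ge -n_0,\ n\neq 0} a_f(n)\,(\mathcal L\varphi_s)(2\pi n),$$ where $(\mathcal L\varphi)(p)=\int_0^\infty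 e^{-pt}\varphi(t)\,dt$ if the integral converges absolutely, and where, at a negative real number $p$, $(\mathcal L\varphi)(p)$ is the limit at $p$, from within the upper half-plane, of the analytic continuation of $\mathcal L\varphi$ through the upper half-plane. Thus $(\mathcal L\varphi_s)(2\pi n)=E_{1-s}(2\pi n/\sqrt N)$ with the principal branch of the generalised exponential integral, continued to the negative real axis from above. Then, for every $s\in\mathbb C$, all terms of the series are defined and the series converges absolutely. Moreover $s\mapsto\Lambda(f,s)$ is complex differentiable at $s=1$, with derivative $$\Lambda'(f,1)=\sqrt N\, i\int_{i/\sqrt N}^{i/\sqrt N+1} f(z)\Big(\log(\Gamma(z))+\big(\log\sqrt N-\tfrac{\pi i}{2}\big)z\Big)\,dz ,$$ where the integral is over the horizontal segment and $\log$ is the principal branch of the logarithm. -/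

import Mathlib

open scoped UpperHalfPlane ModularForm MatrixGroups

noncomputable section

/-- The Fricke matrix `W_N`, with rows `(0, -1/√N)` and `(√N, 0)`, in `SL₂(ℝ)`. -/
def frickeMatrix (N : ℕ) [NeZero N] : SL(2, ℝ) :=
  ⟨!![0, -1 / √(N : ℝ); √(N : ℝ), 0], by
    have h : √(N : ℝ) ≠ 0 :=
      (Real.sqrt_pos.mpr (Nat.cast_pos.mpr (Nat.pos_of_ne_zero (NeZero.ne N)))).ne'
    rw [Matrix.det_fin_two_of]
    field_simp
    norm_num⟩

/-- Weakly holomorphic modular forms of weight `k` for `Γ₀(N)`: holomorphic functions on `ℍ`,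
invariant under the weight `k` action of `Γ₀(N)`, and meromorphic at every cusp. Every cusp is
`γ ∞` for some `γ ∈ SL₂(ℤ)`; the function `f ∣[k] γ` has period `N`, and it has to be meromorphic
at `0` as a function of `q = exp (2 π i z / N)`. -/
structure IsWeaklyHolomorphicModularForm (N : ℕ) (k : ℤ) (f : ℍ → ℂ) : Prop where
  holomorphic : DifferentiableOn ℂ (f ∘ UpperHalfPlane.ofComplex) {z : ℂ | 0 < z.im}
  slash_eq : ∀ γ ∈ CongruenceSubgroup.Gamma0 N, f ∣[k] γ = f
  meromorphic_at_cusps : ∀ γ : SL(2, ℤ), MeromorphicAt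
    (Function.Periodic.cuspFunction (N : ℝ) ((f ∣[k] γ) ∘ UpperHalfPlane.ofComplex)) 0

/-- The coefficient `a_f(n)` of the expansion `f(z) = ∑ a_f(n) exp (2 π i n z)` of a holomorphic
function of period `1` on `ℍ`. The integral is taken over the line `im z = 1`. -/
def expansionCoeff (f : ℍ → ℂ) (n : ℤ) : ℂ :=
  ∫ x in (0 : ℝ)..1, f (UpperHalfPlane.ofComplex (x + Complex.I)) *
    Complex.exp (-(2 * Real.pi * Complex.I * n * (x + Complex.I)))

/-- Weakly holomorphic cusp forms: the expansion at `∞` has no constant term. No condition is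
imposed on the constant terms at the other cusps, so that the forms for which the constant terms
at all cusps vanish are included. -/
structure IsWeaklyHolomorphicCuspForm (N : ℕ) (k : ℤ) (f : ℍ → ℂ) : Prop
    extends IsWeaklyHolomorphicModularForm N k f where
  coeff_zero : expansionCoeff f 0 = 0

/-- Absolute convergence of the Laplace integral of `φ` at `p`. -/
def LaplaceConverges (φ : ℝ → ℂ) (p : ℂ) : Prop :=
  MeasureTheory.IntegrableOn (fun t : ℝ => Complex.exp (-(p * t)) * φ t) (Set.Ioi 0)

/-- The Laplace integral `∫₀^∞ exp (-p t) φ(t) dt`. -/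
def laplaceIntegral (φ : ℝ → ℂ) (p : ℂ) : ℂ :=
  ∫ t in Set.Ioi (0 : ℝ), Complex.exp (-(p * t)) * φ t

/-- `L` is the value at the real point `x` of the continuation of the Laplace transform of `φ`
through the upper half-plane: the integral converges absolutely for `re p ≥ σ`, it continues
analytically to the part `re p > x - ε` of the upper half-plane, and the continuation tends to `L`
at `x`. There is at most one such `L`. -/
def IsLaplaceContinuation (φ : ℝ → ℂ) (x : ℝ) (L : ℂ) : Prop :=
  ∃ (σ ε : ℝ) (F : ℂ → ℂ), 0 < ε ∧
    (∀ p : ℂ, σ ≤ p.re → LaplaceConverges φ p) ∧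
    DifferentiableOn ℂ F {p : ℂ | 0 < p.im ∧ x - ε < p.re} ∧
    (∀ p : ℂ, 0 < p.im → x - ε < p.re → σ ≤ p.re → F p = laplaceIntegral φ p) ∧
    Filter.Tendsto F (nhdsWithin (x : ℂ) {p : ℂ | 0 < p.im}) (nhds L)

open Classical in
/-- The Laplace transform `(ℒ φ)(x)` at a real point `x`: the integral where it converges
absolutely, and the value of its continuation through the upper half-plane elsewhere (and `0`
if there is none). -/
def laplace (φ : ℝ → ℂ) (x : ℝ) : ℂ :=
  if LaplaceConverges φ x then laplaceIntegral φ x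
  else if h : ∃ L, IsLaplaceContinuation φ x L then h.choose else 0

/-- `(ℒ φ)(2 π n)` is defined for every `n ≠ 0` with `a_f(n) ≠ 0`, and the series
`∑ a_f(n) (ℒ φ)(2 π n)` converges absolutely. -/
def LSeriesDefined (f : ℍ → ℂ) (φ : ℝ → ℂ) : Prop :=
  (∀ n : ℤ, n ≠ 0 → expansionCoeff f n ≠ 0 →
    LaplaceConverges φ ((2 * Real.pi * n : ℝ) : ℂ) ∨
      ∃ L, IsLaplaceContinuation φ (2 * Real.pi * n) L) ∧
  Summable fun n : {n : ℤ // n ≠ 0} => expansionCoeff f n * laplace φ (2 * Real.pi * (n : ℤ))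

/-- The `L`-series `Λ_f(φ) = ∑_{n ≠ 0} a_f(n) (ℒ φ)(2 π n)` of `f` at the test function `φ`. -/
def lSeries (f : ℍ → ℂ) (φ : ℝ → ℂ) : ℂ :=
  ∑' n : {n : ℤ // n ≠ 0}, expansionCoeff f n * laplace φ (2 * Real.pi * (n : ℤ))

/-- The test function `φ_s^w(t) = 1_{[1/√N, ∞)}(t) N^{s/2} exp (-w t) t^{s-1}`. -/
def testFunction (N : ℕ) (s w : ℂ) (t : ℝ) : ℂ :=
  (Set.Ici (1 / √(N : ℝ))).indicator
    (fun t : ℝ => (N : ℂ) ^ (s / 2) * Complex.exp (-(w * t)) * (t : ℂ) ^ (s - 1)) t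

/-- `Λ(f, s) = Λ_f(φ_s^0)`. -/
def centralLambda (N : ℕ) (f : ℍ → ℂ) (s : ℂ) : ℂ :=
  lSeries f (testFunction N s 0)

end

noncomputable section

open Complex MeasureTheory Set Filter Topology

/-! ### Oscillatory integrals -/

/-! Put a = 1/√N and q = 2πna. Scaling t by a turns the n-th transform into ∫_1^∞ e^{-qt} t^{s-1}
dt. For q in the open first quadrant the ray can be turned to 1 - iv, giving -i e^{-q} times
`oscIntegral s q` (`integral_Ioi_eq_oscIntegral`). The rotated integral is holomorphic on the whole
upper half-plane, and repeated integration by parts (`oscExtension`) carries it continuously to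
nonzero real q for every s, boundedly for |q| ≥ c. One formula, `laplace_testFunction`, therefore
covers both signs of n, and absolute convergence reduces to that of the Fourier expansion of f on
the line im z = a.

One integration by parts isolates a factor s - 1, so the difference quotient of Λ at 1 is the series
`centralSlope`. It is continuous at 1, and its value there, a series in e^{-q} `oscExtension 1 0 q`
/ q, is the derivative.

For the integral side, f is expanded on the segment and integrated termwise against log Γ(z) + Cz,
where C = log √N - πi/2 = -log(ai). The coefficients of log Γ come from Euler's limit z log M + log
M! - ∑ log(z + m): against a 1-periodic exponential the unit integrals of the logarithms glue to a
single integral over [0, M + 1]. Two integrations by parts and M → ∞ produce the same oscillatory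
integral (`integral_exp_mul_log_Gamma`); the term Cz removes the boundary term log(ai). That Euler's
limit is the principal logarithm of Γ follows from bounds on its imaginary part
(`tendsto_complexLogGammaSeq`). -/

theorem isBigO_exp_neg_mul_one_add_sq_rpow {c : ℝ} (hc : 0 < c) (r : ℝ) :
    (fun v : ℝ => Real.exp (-c * v) * (1 + v ^ 2) ^ r) =O[atTop]
      fun v => Real.exp (-(c / 2) * v) := by
  have h1 : (fun v : ℝ => (1 + v ^ 2) ^ r) =O[atTop] fun v => v ^ (2 * |r|) := by
    refine Asymptotics.IsBigO.of_bound ((2 : ℝ) ^ |r|) ?_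
    filter_upwards [eventually_ge_atTop 1] with v hv
    have hv0 : (0 : ℝ) < v := by linarith
    rw [Real.norm_of_nonneg (by positivity), Real.norm_of_nonneg (by positivity)]
    calc (1 + v ^ 2) ^ r ≤ (1 + v ^ 2) ^ |r| :=
          Real.rpow_le_rpow_of_exponent_le (by nlinarith) (le_abs_self r)
      _ ≤ (2 * v ^ 2) ^ |r| := Real.rpow_le_rpow (by positivity) (by nlinarith) (abs_nonneg r)
      _ = 2 ^ |r| * v ^ (2 * |r|) := by
          rw [Real.mul_rpow (by norm_num) (by positivity), Real.rpow_mul hv0.le]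
          norm_num
  have h2 := h1.trans (isLittleO_rpow_exp_pos_mul_atTop (2 * |r|) (half_pos hc)).isBigO
  refine ((Asymptotics.isBigO_refl (fun v : ℝ => Real.exp (-c * v)) atTop).mul h2).congr_right ?_
  intro v
  rw [← Real.exp_add]
  ring_nf

theorem tendsto_exp_neg_mul_one_add_sq_rpow_zero {c : ℝ} (hc : 0 < c) (r : ℝ) :
    Tendsto (fun v : ℝ => Real.exp (-c * v) * (1 + v ^ 2) ^ r) atTop (𝓝 0) := by
  refine (isBigO_exp_neg_mul_one_add_sq_rpow hc r).trans_tendsto ?_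
  refine Real.tendsto_exp_atBot.comp ?_
  exact (tendsto_const_mul_atBot_of_neg (by linarith)).2 tendsto_id

theorem integrableOn_exp_neg_mul_one_add_sq_rpow {c : ℝ} (hc : 0 < c) (r : ℝ) :
    IntegrableOn (fun v : ℝ => Real.exp (-c * v) * (1 + v ^ 2) ^ r) (Ioi 0) := by
  refine integrable_of_isBigO_exp_neg (half_pos hc) ?_ ?_
  · have : ∀ v : ℝ, 1 + v ^ 2 ≠ 0 := fun v => by positivity
    exact (Continuous.mul (by fun_prop)
      (Continuous.rpow_const (by fun_prop) fun v => Or.inl (this v))).continuousOn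
  · exact isBigO_exp_neg_mul_one_add_sq_rpow hc r

/-- Either source of decay suffices: the exponential inside the half-plane, or the power alone on
the real boundary c = 0. -/
theorem integrableOn_exp_neg_mul_one_add_sq_rpow_of_le {c r : ℝ} (hc : 0 ≤ c) (h : r < -1 ∨ 0 < c) :
    IntegrableOn (fun v : ℝ => Real.exp (-c * v) * (1 + v ^ 2) ^ (r / 2)) (Ioi 0) := by
  rcases hc.eq_or_lt with rfl | hc
  · have hr : r < -1 := by simpa using h
    have := integrable_rpow_neg_one_add_norm_sq (E := ℝ) (μ := volume) (r := -r) (by simp; linarith)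
    simp only [neg_neg, Real.norm_eq_abs, sq_abs] at this
    simpa using this.integrableOn
  · exact integrableOn_exp_neg_mul_one_add_sq_rpow hc _

theorem norm_cpow_le_exp_mul (z w : ℂ) : ‖z ^ w‖ ≤ Real.exp (Real.pi * |w.im|) * ‖z‖ ^ w.re := by
  refine (norm_cpow_le z w).trans ?_
  rw [div_eq_mul_inv, ← Real.exp_neg, mul_comm]
  refine mul_le_mul_of_nonneg_right (Real.exp_le_exp.2 ?_) (by positivity)
  have h1 : |arg z * w.im| ≤ Real.pi * |w.im| := by
    rw [abs_mul]
    exact mul_le_mul_of_nonneg_right (abs_arg_le_pi z) (abs_nonneg _)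
  exact (neg_le_abs _).trans h1

theorem norm_one_sub_I_mul (v : ℝ) : ‖(1 : ℂ) - I * v‖ = (1 + v ^ 2) ^ (1 / 2 : ℝ) := by
  rw [← Real.sqrt_eq_rpow, Complex.norm_def, normSq_apply]
  simp
  ring_nf

/-- Only one-sided bounds on q and w enter, so the right side serves as a locally uniform majorant.
The imaginary part of the exponent costs a constant, because arguments are bounded by π. -/
theorem norm_exp_mul_one_sub_I_mul_cpow_le {q w : ℂ} {v c r M : ℝ} (hv : 0 ≤ v) (hq : c ≤ q.im)
    (hr : w.re ≤ r) (hM : |w.im| ≤ M) :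
    ‖cexp (I * q * v) * (1 - I * v) ^ w‖ ≤
      Real.exp (Real.pi * M) * (Real.exp (-c * v) * (1 + v ^ 2) ^ (r / 2)) := by
  rw [norm_mul, norm_exp]
  have h1 : ‖((1 : ℂ) - I * v) ^ w‖ ≤ Real.exp (Real.pi * M) * (1 + v ^ 2) ^ (r / 2) := by
    refine (norm_cpow_le_exp_mul _ _).trans ?_
    rw [norm_one_sub_I_mul, ← Real.rpow_mul (by positivity)]
    gcongr
    · nlinarith
    · linarith
  have h2 : (I * q * v).re = -q.im * v := by simp
  rw [h2]
  calc Real.exp (-q.im * v) * ‖((1 : ℂ) - I * v) ^ w‖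
      ≤ Real.exp (-c * v) * (Real.exp (Real.pi * M) * (1 + v ^ 2) ^ (r / 2)) := by
        gcongr
    _ = _ := by ring

theorem one_sub_I_mul_mem_slitPlane (v : ℝ) : (1 : ℂ) - I * v ∈ slitPlane := by
  left; simp

theorem continuous_one_sub_I_mul_cpow (w : ℂ) :
    Continuous fun v : ℝ => ((1 : ℂ) - I * v) ^ w :=
  Continuous.cpow (by fun_prop) continuous_const one_sub_I_mul_mem_slitPlane

/-- The integral `∫₀^∞ exp (i q v) (1 - i v)^(s - 1) dv`. -/
def oscIntegral (s q : ℂ) : ℂ :=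
  ∫ v in Ioi (0 : ℝ), cexp (I * q * v) * (1 - I * v) ^ (s - 1)

theorem aestronglyMeasurable_osc (w q : ℂ) :
    AEStronglyMeasurable (fun v : ℝ => cexp (I * q * v) * (1 - I * v) ^ w)
      (volume.restrict (Ioi 0)) :=
  (Continuous.mul (by fun_prop) (continuous_one_sub_I_mul_cpow w)).aestronglyMeasurable

theorem integrableOn_osc {w q : ℂ} (hq : 0 ≤ q.im) (h : w.re < -1 ∨ 0 < q.im) :
    IntegrableOn (fun v : ℝ => cexp (I * q * v) * (1 - I * v) ^ w) (Ioi 0) := by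
  refine Integrable.mono' ((integrableOn_exp_neg_mul_one_add_sq_rpow_of_le hq h).const_mul
    (Real.exp (Real.pi * |w.im|))) (aestronglyMeasurable_osc w q) ?_
  filter_upwards [ae_restrict_mem measurableSet_Ioi] with v hv
  exact norm_exp_mul_one_sub_I_mul_cpow_le (le_of_lt hv) le_rfl le_rfl le_rfl

theorem norm_oscIntegral_le {s q : ℂ} {r M : ℝ} (hr : r < 0) (hs : s.re ≤ r) (hM : |s.im| ≤ M)
    (hq : 0 ≤ q.im) :
    ‖oscIntegral s q‖ ≤ ∫ v in Ioi (0 : ℝ),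
      Real.exp (Real.pi * M) * (Real.exp (-0 * v) * (1 + v ^ 2) ^ ((r - 1) / 2)) := by
  refine norm_integral_le_of_norm_le
    ((integrableOn_exp_neg_mul_one_add_sq_rpow_of_le le_rfl (Or.inl (by linarith))).const_mul _) ?_
  filter_upwards [ae_restrict_mem measurableSet_Ioi] with v hv
  exact norm_exp_mul_one_sub_I_mul_cpow_le (le_of_lt hv) hq (by simpa using hs) (by simpa using hM)

theorem continuousOn_oscIntegral :
    ContinuousOn (fun x : ℂ × ℂ => oscIntegral x.1 x.2) {x | x.1.re < 0 ∧ 0 ≤ x.2.im} := by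
  rintro ⟨s, q⟩ ⟨hs, hq⟩
  -- Dominated convergence needs one majorant near s; requiring re ≤ re s / 2 < 0 keeps the power of
  -- v integrable uniformly.
  have key : ContinuousOn (fun x : ℂ × ℂ => oscIntegral x.1 x.2)
      {x | (x.1.re ≤ s.re / 2 ∧ |x.1.im| ≤ |s.im| + 1) ∧ 0 ≤ x.2.im} := by
    refine continuousOn_of_dominated (bound := fun v : ℝ => Real.exp (Real.pi * (|s.im| + 1)) *
      (Real.exp (-0 * v) * (1 + v ^ 2) ^ ((s.re / 2 - 1) / 2))) ?_ ?_ ?_ ?_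
    · intro x _
      exact aestronglyMeasurable_osc _ _
    · rintro x ⟨⟨h1, h2⟩, h3⟩
      filter_upwards [ae_restrict_mem measurableSet_Ioi] with v hv
      exact norm_exp_mul_one_sub_I_mul_cpow_le (le_of_lt hv) h3 (by simpa using h1)
        (by simpa using h2)
    · have hs' : s.re < 0 := hs
      exact (integrableOn_exp_neg_mul_one_add_sq_rpow_of_le le_rfl
        (Or.inl (by linarith))).const_mul _
    · refine Eventually.of_forall fun v => Continuous.continuousOn ?_
      refine Continuous.mul (by fun_prop) ?_
      exact Continuous.const_cpow (by fun_prop)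
        (Or.inl (slitPlane_ne_zero (one_sub_I_mul_mem_slitPlane v)))
  refine (key (s, q) ⟨⟨?_, ?_⟩, hq⟩).mono_of_mem_nhdsWithin ?_
  · have hs' : s.re < 0 := hs
    simp only
    linarith
  · simp
  · have hs' : s.re < 0 := hs
    have h1 : ∀ᶠ x : ℂ × ℂ in 𝓝 (s, q), x.1.re < s.re / 2 :=
      ContinuousAt.eventually_lt (by fun_prop) (by fun_prop) (by simp only; linarith)
    have h2 : ∀ᶠ x : ℂ × ℂ in 𝓝 (s, q), |x.1.im| < |s.im| + 1 :=
      ContinuousAt.eventually_lt (by fun_prop) (by fun_prop) (by simp)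
    filter_upwards [nhdsWithin_le_nhds h1, nhdsWithin_le_nhds h2, self_mem_nhdsWithin]
      with x h1 h2 h3
    exact ⟨⟨h1.le, h2.le⟩, h3.2⟩

theorem differentiableOn_oscIntegral (s : ℂ) :
    DifferentiableOn ℂ (oscIntegral s) {q | 0 < q.im} := by
  intro q hq
  have hq' : 0 < q.im := hq
  refine DifferentiableAt.differentiableWithinAt ?_
  refine (hasDerivAt_integral_of_dominated_loc_of_deriv_le
    (F' := fun (p : ℂ) (v : ℝ) => (I * v) * (cexp (I * p * v) * (1 - I * v) ^ (s - 1)))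
    (bound := fun v : ℝ => Real.exp (Real.pi * |s.im|) *
      (Real.exp (-(q.im / 2) * v) * (1 + v ^ 2) ^ (s.re / 2)))
    (s := {p : ℂ | q.im / 2 < p.im}) ?_ ?_ ?_ ?_ ?_ ?_ ?_).2.differentiableAt
  · exact (isOpen_lt continuous_const continuous_im).mem_nhds (by simp only [mem_ofPred]; linarith)
  · exact Eventually.of_forall fun p => aestronglyMeasurable_osc _ _
  · exact integrableOn_osc hq'.le (Or.inr hq')
  · exact AEStronglyMeasurable.mul (Continuous.aestronglyMeasurable (by fun_prop))
      (aestronglyMeasurable_osc _ _)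
  · filter_upwards [ae_restrict_mem measurableSet_Ioi] with v hv p hp
    have hv' : (0 : ℝ) < v := hv
    have hp' : q.im / 2 < p.im := hp
    have h1 := norm_exp_mul_one_sub_I_mul_cpow_le (q := p) (w := s - 1) hv'.le hp'.le le_rfl le_rfl
    rw [norm_mul]
    -- The factor v created by differentiating in q is absorbed by raising the exponent of 1 + v² by
    -- 1/2.
    have h2 : ‖I * (v : ℂ)‖ ≤ (1 + v ^ 2) ^ (1 / 2 : ℝ) := by
      rw [norm_mul, norm_I, one_mul, norm_real, Real.norm_of_nonneg hv'.le, ← Real.sqrt_eq_rpow]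
      exact Real.le_sqrt_of_sq_le (by linarith)
    refine (mul_le_mul h2 h1 (norm_nonneg _) (by positivity)).trans (le_of_eq ?_)
    have h3 : (1 + v ^ 2) ^ (s.re / 2) =
        (1 + v ^ 2) ^ (1 / 2 : ℝ) * (1 + v ^ 2) ^ ((s - 1).re / 2) := by
      rw [← Real.rpow_add (by positivity)]
      congr 1
      simp
      ring
    rw [h3]
    simp
    ring
  · exact (integrableOn_exp_neg_mul_one_add_sq_rpow (by linarith) _).const_mul _
  · refine Eventually.of_forall fun v p _ => ?_
    have h := ((((hasDerivAt_id p).const_mul I).mul_const (v : ℂ)).cexp).mul_const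
      (((1 : ℂ) - I * v) ^ (s - 1))
    convert! h using 1
    simp
    ring

/-- Integration by parts in v: the end v = 0 contributes the constant I, and lowering s by one
improves the decay in v, which makes the right side meaningful further to the right in s when q is
real. -/
theorem oscIntegral_recursion {s q : ℂ} (hq : 0 < q.im) :
    oscIntegral s q = (I + (s - 1) * oscIntegral (s - 1) q) / q := by
  have hq0 : q ≠ 0 := by rintro rfl; simp at hq
  have hd : ∀ v ∈ Ici (0 : ℝ), HasDerivAt (fun v : ℝ => cexp (I * q * v) * (1 - I * v) ^ (s - 1))
      ((I * q) * (cexp (I * q * v) * (1 - I * v) ^ (s - 1)) +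
        (-I * (s - 1)) * (cexp (I * q * v) * (1 - I * v) ^ (s - 1 - 1))) v := by
    intro v _
    have h1 : HasDerivAt (fun v : ℝ => I * q * (v : ℂ)) (I * q) v := by
      simpa using (ofRealCLM.hasDerivAt (x := v)).const_mul (I * q)
    have h2 : HasDerivAt (fun v : ℝ => 1 - I * (v : ℂ)) (-I) v := by
      simpa using ((ofRealCLM.hasDerivAt (x := v)).const_mul I).const_sub 1
    have h3 := (HasDerivAt.comp_of_eq v
      (hasStrictDerivAt_cpow_const (c := s - 1) (one_sub_I_mul_mem_slitPlane v)).hasDerivAt h2 rfl)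
    convert! h1.cexp.mul h3 using 1
    simp only [Function.comp_apply]
    ring
  have hi1 := integrableOn_osc (w := s - 1) hq.le (Or.inr hq)
  have hi2 := integrableOn_osc (w := s - 1 - 1) hq.le (Or.inr hq)
  have ht : Tendsto (fun v : ℝ => cexp (I * q * v) * (1 - I * v) ^ (s - 1)) atTop (𝓝 0) := by
    have h := (tendsto_exp_neg_mul_one_add_sq_rpow_zero hq ((s - 1).re / 2)).const_mul
      (Real.exp (Real.pi * |(s - 1).im|))
    rw [mul_zero] at h
    refine squeeze_zero_norm' ?_ h
    filter_upwards [eventually_ge_atTop 0] with v hv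
    exact norm_exp_mul_one_sub_I_mul_cpow_le hv le_rfl le_rfl le_rfl
  have h := integral_Ioi_of_hasDerivAt_of_tendsto' hd
    ((hi1.const_mul _).add (hi2.const_mul _)) ht
  rw [integral_add (hi1.const_mul _) (hi2.const_mul _), integral_const_mul,
    integral_const_mul] at h
  change I * q * oscIntegral s q + -I * (s - 1) * oscIntegral (s - 1) q = _ at h
  simp only [ofReal_zero, mul_zero, Complex.exp_zero, sub_zero, one_cpow, mul_one, zero_sub] at h
  rw [eq_div_iff hq0]
  linear_combination (-I) * h + (oscIntegral s q * q - (s - 1) * oscIntegral (s - 1) q) * I_sq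

/-- The extension of `oscIntegral` to `re s < k` and `im q ≥ 0`, `q ≠ 0`, obtained by `k`
integrations by parts. -/
def oscExtension : ℕ → ℂ → ℂ → ℂ
  | 0, s, q => oscIntegral s q
  | k + 1, s, q => (I + (s - 1) * oscExtension k (s - 1) q) / q

theorem oscExtension_succ (k : ℕ) (s q : ℂ) :
    oscExtension (k + 1) s q = (I + (s - 1) * oscExtension k (s - 1) q) / q :=
  rfl

theorem oscExtension_eq_oscIntegral (k : ℕ) (s : ℂ) {q : ℂ} (hq : 0 < q.im) :
    oscExtension k s q = oscIntegral s q := by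
  induction k generalizing s with
  | zero => rfl
  | succ k ih => rw [oscExtension, ih, ← oscIntegral_recursion hq]

theorem continuousOn_oscExtension (k : ℕ) :
    ContinuousOn (fun x : ℂ × ℂ => oscExtension k x.1 x.2)
      {x | x.1.re < k ∧ 0 ≤ x.2.im ∧ x.2 ≠ 0} := by
  induction k with
  | zero =>
    refine continuousOn_oscIntegral.mono ?_
    rintro x ⟨h1, h2, h3⟩
    exact ⟨by simpa using h1, h2⟩
  | succ k ih =>
    simp only [oscExtension]
    have h : ContinuousOn (fun x : ℂ × ℂ => oscExtension k (x.1 - 1) x.2)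
        {x | x.1.re < (k + 1 : ℕ) ∧ 0 ≤ x.2.im ∧ x.2 ≠ 0} := by
      refine ContinuousOn.comp (g := fun x : ℂ × ℂ => oscExtension k x.1 x.2)
        (f := fun x : ℂ × ℂ => (x.1 - 1, x.2)) ih (by fun_prop) ?_
      rintro x ⟨h1, h2, h3⟩
      refine ⟨?_, h2, h3⟩
      push_cast at h1
      simp only [sub_re, one_re]
      linarith
    refine ContinuousOn.div ?_ (by fun_prop) fun x hx => hx.2.2
    exact continuousOn_const.add (ContinuousOn.mul (by fun_prop) h)

/-- Uniformity in q is what allows summation over n; each integration by parts costs a division by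
|q| ≥ c. -/
theorem exists_norm_oscExtension_le (k : ℕ) {r M c : ℝ} (hr : r < k) (hc : 0 < c) :
    ∃ B : ℝ, ∀ s q : ℂ, s.re ≤ r → ‖s‖ ≤ M → 0 ≤ q.im → c ≤ ‖q‖ →
      ‖oscExtension k s q‖ ≤ B := by
  induction k generalizing r M with
  | zero =>
    refine ⟨_, fun s q hs hM hq _ => norm_oscIntegral_le (M := M) (by simpa using hr) hs
      ((abs_im_le_norm s).trans hM) hq⟩
  | succ k ih =>
    obtain ⟨B, hB⟩ := ih (r := r - 1) (M := M + 1) (by push_cast at hr; linarith)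
    refine ⟨(1 + (M + 1) * B) / c, fun s q hs hM hq hcq => ?_⟩
    have hs1 : ‖s - 1‖ ≤ M + 1 := (norm_sub_le _ _).trans (by simpa using hM)
    have h1 := hB (s - 1) q (by simpa using hs) hs1 hq hcq
    have hM0 := (norm_nonneg _).trans hs1
    have hB0 := (norm_nonneg _).trans h1
    rw [oscExtension, norm_div]
    refine div_le_div₀ (by positivity) ?_ hc hcq
    refine (norm_add_le _ _).trans ?_
    rw [norm_I, norm_mul]
    gcongr

/-! ### Rotation of the path of integration -/

/-- This controls the two far edges of the square with opposite corners 1 and 1 + R - iR. The real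
part of -qt is a sum of two nonpositive terms, one of which is at most -min(re q, im q) R there. -/
theorem norm_exp_neg_mul_mul_cpow_le {q s t : ℂ} {R : ℝ} (ht1 : 1 ≤ t.re) (ht : t.re ≤ 1 + R)
    (hi : t.im ≤ 0) (hi' : -R ≤ t.im) (hq : 0 < q.re) (hq' : 0 < q.im)
    (hR : t.re = 1 + R ∨ t.im = -R) :
    ‖cexp (-q * t) * t ^ (s - 1)‖ ≤ Real.exp (Real.pi * |s.im|) * 2 ^ |s.re - 1| *
      (Real.exp (-(min q.re q.im) * R) * (1 + R ^ 2) ^ |s.re - 1|) := by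
  have hR0 : 0 ≤ R := by linarith
  have h1 : ‖cexp (-q * t)‖ ≤ Real.exp (-(min q.re q.im) * R) := by
    rw [norm_exp]
    refine Real.exp_le_exp.2 ?_
    have h2 := min_le_left q.re q.im
    have h3 := min_le_right q.re q.im
    have h4 : 0 < min q.re q.im := lt_min hq hq'
    simp only [mul_re, neg_re, neg_im]
    rcases hR with h | h
    · rw [h]; nlinarith [mul_nonneg hq'.le (neg_nonneg.2 hi)]
    · rw [h]; nlinarith
  have hn : ‖t‖ ≤ 2 * (1 + R ^ 2) := by
    refine (norm_le_abs_re_add_abs_im t).trans ?_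
    rw [abs_of_nonneg (by linarith), abs_of_nonpos hi]
    nlinarith [sq_nonneg (R - 1)]
  have hn1 : 1 ≤ ‖t‖ := ht1.trans ((le_abs_self _).trans (abs_re_le_norm t))
  have h5 : ‖t ^ (s - 1)‖ ≤ Real.exp (Real.pi * |s.im|) *
      (2 ^ |s.re - 1| * (1 + R ^ 2) ^ |s.re - 1|) := by
    refine (norm_cpow_le_exp_mul _ _).trans ?_
    simp only [sub_im, one_im, sub_zero, sub_re, one_re]
    gcongr
    rw [← Real.mul_rpow (by norm_num) (by positivity)]
    exact (Real.rpow_le_rpow_of_exponent_le hn1 (le_abs_self _)).trans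
      (Real.rpow_le_rpow (norm_nonneg _) hn (abs_nonneg _))
  rw [norm_mul]
  refine (mul_le_mul h1 h5 (norm_nonneg _) (Real.exp_pos _).le).trans (le_of_eq ?_)
  ring

theorem integrableOn_exp_neg_mul_mul_cpow {q : ℂ} (hq : 0 < q.re) (s : ℂ) {a : ℝ} (ha : 0 < a) :
    IntegrableOn (fun t : ℝ => cexp (-q * t) * (t : ℂ) ^ (s - 1)) (Ioi a) := by
  have hm : ContinuousOn (fun t : ℝ => cexp (-q * t) * (t : ℂ) ^ (s - 1)) (Ioi a) := by
    refine ContinuousOn.mul (by fun_prop) (ContinuousOn.cpow (by fun_prop) continuousOn_const ?_)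
    intro t ht
    exact ofReal_mem_slitPlane.2 (ha.trans ht)
  refine integrable_of_isBigO_exp_neg (f := fun t : ℝ => Real.exp (-q.re * t) * t ^ (s.re - 1))
    (a := a) (b := q.re / 2) (by linarith) ?_ ?_ |>.mono' (hm.aestronglyMeasurable
      measurableSet_Ioi) ?_
  · refine ContinuousOn.mul (by fun_prop) (ContinuousOn.rpow_const (by fun_prop) ?_)
    intro t ht
    exact Or.inl (ha.trans_le ht).ne'
  · have h := (isLittleO_rpow_exp_pos_mul_atTop (s.re - 1) (half_pos hq)).isBigO
    refine ((Asymptotics.isBigO_refl (fun v : ℝ => Real.exp (-q.re * v)) atTop).mul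
      h).congr_right ?_
    intro v
    rw [← Real.exp_add]
    ring_nf
  · filter_upwards [ae_restrict_mem measurableSet_Ioi] with t ht
    rw [norm_mul, norm_exp, norm_cpow_eq_rpow_re_of_pos (ha.trans ht)]
    simp

theorem integral_Ioi_eq_oscIntegral {q : ℂ} (hq : 0 < q.re) (hq' : 0 < q.im) (s : ℂ) :
    ∫ t in Ioi (1 : ℝ), cexp (-q * t) * (t : ℂ) ^ (s - 1) =
      -I * cexp (-q) * oscIntegral s q := by
  set f : ℂ → ℂ := fun t => cexp (-q * t) * t ^ (s - 1) with hf
  have hd : ∀ t : ℂ, 1 ≤ t.re → DifferentiableAt ℂ f t := by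
    intro t ht
    refine DifferentiableAt.mul (by fun_prop) (DifferentiableAt.cpow_const (by fun_prop) ?_)
    left
    linarith
  have hc : 0 < min q.re q.im := lt_min hq hq'
  set A : ℝ := Real.exp (Real.pi * |s.im|) * 2 ^ |s.re - 1|
  -- The exponent is raised by one so that the edge length R, at most 1 + R², is absorbed.
  have hlim : Tendsto (fun R : ℝ => A * (Real.exp (-(min q.re q.im) * R) *
      (1 + R ^ 2) ^ (|s.re - 1| + 1))) atTop (𝓝 0) := by
    simpa using (tendsto_exp_neg_mul_one_add_sq_rpow_zero hc (|s.re - 1| + 1)).const_mul A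
  have hbound : ∀ R : ℝ, 0 ≤ R → A * (Real.exp (-(min q.re q.im) * R) *
      (1 + R ^ 2) ^ |s.re - 1|) * R ≤ A * (Real.exp (-(min q.re q.im) * R) *
      (1 + R ^ 2) ^ (|s.re - 1| + 1)) := by
    intro R hR
    have h1 : R ≤ 1 + R ^ 2 := by nlinarith [sq_nonneg (R - 1)]
    refine (mul_le_mul_of_nonneg_left h1 (by positivity)).trans (le_of_eq ?_)
    rw [Real.rpow_add_one (by positivity)]
    ring
  have hbot : Tendsto (fun R : ℝ => ∫ x in (1 : ℝ)..1 + R, f (x + (-R : ℝ) * I)) atTop (𝓝 0) := by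
    refine squeeze_zero_norm' ?_ hlim
    filter_upwards [eventually_ge_atTop 0] with R hR
    refine (intervalIntegral.norm_integral_le_of_norm_le_const (C := A *
      (Real.exp (-(min q.re q.im) * R) * (1 + R ^ 2) ^ |s.re - 1|)) ?_).trans ?_
    · intro x hx
      rw [uIoc_of_le (by linarith)] at hx
      exact norm_exp_neg_mul_mul_cpow_le (by simpa using hx.1.le) (by simpa using hx.2)
        (by simpa using hR) (by simp) hq hq' (Or.inr (by simp))
    · rw [add_sub_cancel_left, abs_of_nonneg hR]
      exact hbound R hR
  have hright : Tendsto (fun R : ℝ => ∫ y in (-R)..0, f ((1 + R : ℝ) + y * I)) atTop (𝓝 0) := by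
    refine squeeze_zero_norm' ?_ hlim
    filter_upwards [eventually_ge_atTop 0] with R hR
    refine (intervalIntegral.norm_integral_le_of_norm_le_const (C := A *
      (Real.exp (-(min q.re q.im) * R) * (1 + R ^ 2) ^ |s.re - 1|)) ?_).trans ?_
    · intro x hx
      rw [uIoc_of_le (by linarith)] at hx
      exact norm_exp_neg_mul_mul_cpow_le (by simpa using hR) (by simp)
        (by simpa using hx.2) (by simpa using hx.1.le) hq hq' (Or.inl (by simp))
    · rw [zero_sub, neg_neg, abs_of_nonneg hR]
      exact hbound R hR
  have htop : Tendsto (fun R : ℝ => ∫ x in (1 : ℝ)..1 + R, f x) atTop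
      (𝓝 (∫ t in Ioi (1 : ℝ), f t)) :=
    intervalIntegral_tendsto_integral_Ioi 1 (integrableOn_exp_neg_mul_mul_cpow hq s one_pos)
      (tendsto_atTop_add_const_left _ _ tendsto_id)
  have hleft : Tendsto (fun R : ℝ => ∫ v in (0 : ℝ)..R, f (1 - I * v)) atTop
      (𝓝 (cexp (-q) * oscIntegral s q)) := by
    have h1 : ∀ v : ℝ, f (1 - I * v) = cexp (-q) * (cexp (I * q * v) * (1 - I * v) ^ (s - 1)) := by
      intro v
      rw [hf, ← mul_assoc, ← Complex.exp_add]
      ring_nf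
    simp only [h1]
    rw [oscIntegral, ← integral_const_mul]
    exact intervalIntegral_tendsto_integral_Ioi 0
      ((integrableOn_osc hq'.le (Or.inr hq')).const_mul _) tendsto_id
  -- Cauchy's theorem on the square; its left edge is the beginning of the rotated ray.
  have hrect : ∀ R : ℝ, 0 ≤ R → (∫ x in (1 : ℝ)..1 + R, f x) =
      (∫ x in (1 : ℝ)..1 + R, f (x + (-R : ℝ) * I)) +
        I * (∫ y in (-R)..0, f ((1 + R : ℝ) + y * I)) - I * ∫ v in (0 : ℝ)..R, f (1 - I * v) := by
    intro R hR
    have h := integral_boundary_rect_eq_zero_of_differentiableOn f (1 - R * I) ((1 + R : ℝ)) ?_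
    · simp only [sub_re, one_re, mul_re, ofReal_re, I_re, mul_zero, ofReal_im, I_im, mul_one,
        sub_self, sub_zero, sub_im, one_im, mul_im, zero_sub,
        ofReal_zero, zero_mul, add_zero, smul_eq_mul] at h
      have h2 : (∫ y in (-R)..0, f ((1 : ℝ) + y * I)) = ∫ v in (0 : ℝ)..R, f (1 - I * v) := by
        have := intervalIntegral.integral_comp_neg (a := 0) (b := R)
          (fun y : ℝ => f ((1 : ℝ) + y * I))
        rw [neg_zero] at this
        rw [← this]
        refine intervalIntegral.integral_congr fun v _ => ?_
        simp only [ofReal_neg, ofReal_one]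
        congr 1
        ring
      rw [h2] at h
      linear_combination -h
    · intro t ht
      have h1 := ht.1
      simp only [sub_re, one_re, mul_re, ofReal_re, I_re, mul_zero, ofReal_im, I_im, mul_one,
        sub_self, sub_zero] at h1
      rw [mem_preimage, uIcc_of_le (by linarith)] at h1
      exact (hd t h1.1).differentiableWithinAt
  refine tendsto_nhds_unique htop ?_
  have h := (hbot.add (hright.const_mul I)).sub (hleft.const_mul I)
  rw [mul_zero, zero_add, zero_sub] at h
  rw [show -I * cexp (-q) * oscIntegral s q = -(I * (cexp (-q) * oscIntegral s q)) by ring]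
  refine h.congr' ?_
  filter_upwards [eventually_ge_atTop 0] with R hR
  rw [hrect R hR]

/-! ### The Laplace transform of the test function -/

/-- The rotation needs im q > 0, so x is approached as x + iε: the left side converges by
domination, the right side by continuity of the extension up to the boundary. -/
theorem integral_Ioi_eq_oscExtension_of_pos {x : ℝ} (hx : 0 < x) {s : ℂ} {k : ℕ} (hs : s.re < k) :
    ∫ t in Ioi (1 : ℝ), cexp (-x * t) * (t : ℂ) ^ (s - 1) =
      -I * cexp (-x) * oscExtension k s x := by
  have hpath : Tendsto (fun ε : ℝ => (x : ℂ) + ε * I) (𝓝[>] 0) (𝓝 (x : ℂ)) := by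
    have h : Continuous fun ε : ℝ => (x : ℂ) + ε * I := by fun_prop
    simpa using (h.tendsto 0).mono_left nhdsWithin_le_nhds
  have h1 : Tendsto (fun ε : ℝ => ∫ t in Ioi (1 : ℝ),
      cexp (-((x : ℂ) + ε * I) * t) * (t : ℂ) ^ (s - 1)) (𝓝[>] 0)
      (𝓝 (∫ t in Ioi (1 : ℝ), cexp (-x * t) * (t : ℂ) ^ (s - 1))) := by
    refine tendsto_integral_filter_of_dominated_convergence
      (fun t => ‖cexp (-x * t) * (t : ℂ) ^ (s - 1)‖) ?_ ?_ ?_ ?_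
    · refine Eventually.of_forall fun ε => ?_
      exact (integrableOn_exp_neg_mul_mul_cpow (q := x + ε * I) (by simpa using hx) s
        one_pos).aestronglyMeasurable
    · refine Eventually.of_forall fun ε => Eventually.of_forall fun t => ?_
      rw [norm_mul, norm_mul, norm_exp, norm_exp]
      simp
    · exact (integrableOn_exp_neg_mul_mul_cpow (q := x) (by simpa using hx) s one_pos).norm
    · refine Eventually.of_forall fun t => ?_
      exact Tendsto.mul_const _ ((hpath.neg.mul_const _).cexp)
  have h2 : Tendsto (fun ε : ℝ => oscExtension k s ((x : ℂ) + ε * I)) (𝓝[>] 0)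
      (𝓝 (oscExtension k s x)) := by
    have hx0 : (x : ℂ) ≠ 0 := ofReal_ne_zero.2 hx.ne'
    have h := continuousOn_oscExtension k (s, (x : ℂ)) ⟨hs, by simp, hx0⟩
    refine h.tendsto.comp (f := fun ε : ℝ => (s, (x : ℂ) + ε * I)) ?_
    refine tendsto_nhdsWithin_iff.2 ⟨tendsto_const_nhds.prodMk_nhds hpath, ?_⟩
    filter_upwards [self_mem_nhdsWithin] with ε hε
    have hε' : (0 : ℝ) < ε := hε
    refine ⟨hs, by simpa using hε'.le, fun h0 => ?_⟩
    have h3 : (x : ℂ) + ε * I = 0 := h0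
    have := congrArg re h3
    simp at this
    exact hx.ne' this
  refine tendsto_nhds_unique h1 (((hpath.neg.cexp.const_mul (-I)).mul h2).congr' ?_)
  filter_upwards [self_mem_nhdsWithin] with ε hε
  have hε' : (0 : ℝ) < ε := hε
  rw [oscExtension_eq_oscIntegral _ _ (by simpa using hε'),
    integral_Ioi_eq_oscIntegral (by simpa using hx) (by simpa using hε')]

/-- Both continuations equal the Laplace integral far to the right, and the identity theorem on a
convex quarter-plane carries the equality to x. The choice made in `laplace` is thus harmless. -/
theorem IsLaplaceContinuation.unique {φ : ℝ → ℂ} {x : ℝ} {L L' : ℂ}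
    (h : IsLaplaceContinuation φ x L) (h' : IsLaplaceContinuation φ x L') : L = L' := by
  obtain ⟨σ, ε, F, hε, -, hF, hFL, hFt⟩ := h
  obtain ⟨σ', ε', F', hε', -, hF', hFL', hFt'⟩ := h'
  set U : Set ℂ := {p | 0 < p.im ∧ x - min ε ε' < p.re} with hU
  have hopen : IsOpen U :=
    (isOpen_lt continuous_const continuous_im).inter (isOpen_lt continuous_const continuous_re)
  have hconv : IsPreconnected U :=
    ((convex_halfSpace_im_gt 0).inter (convex_halfSpace_re_gt _)).isPreconnected
  have h1 : DifferentiableOn ℂ F U := hF.mono fun p hp =>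
    ⟨hp.1, lt_of_le_of_lt (by linarith [min_le_left ε ε']) hp.2⟩
  have h2 : DifferentiableOn ℂ F' U := hF'.mono fun p hp =>
    ⟨hp.1, lt_of_le_of_lt (by linarith [min_le_right ε ε']) hp.2⟩
  set p₀ : ℂ := ⟨max x (max σ σ') + 1, 1⟩ with hp₀
  have hm := lt_min hε hε'
  have hp₀U : p₀ ∈ U := by
    refine ⟨by simp [hp₀], ?_⟩
    have := le_max_left x (max σ σ')
    simp only [hp₀]
    linarith
  have heq : F =ᶠ[𝓝 p₀] F' := by
    have h3 : ∀ᶠ p : ℂ in 𝓝 p₀, max x (max σ σ') < p.re :=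
      continuous_re.continuousAt.eventually (lt_mem_nhds (by simp [hp₀]))
    filter_upwards [hopen.mem_nhds hp₀U, h3] with p hp hp3
    have hx : x < p.re := (le_max_left _ _).trans_lt hp3
    have hσ : σ < p.re := ((le_max_left _ _).trans (le_max_right _ _)).trans_lt hp3
    have hσ' : σ' < p.re := ((le_max_right _ _).trans (le_max_right _ _)).trans_lt hp3
    rw [hFL p hp.1 (by linarith) hσ.le, hFL' p hp.1 (by linarith) hσ'.le]
  have hEq : EqOn F F' U := (h1.analyticOnNhd hopen).eqOn_of_preconnected_of_eventuallyEq
    (h2.analyticOnNhd hopen) hconv hp₀U heq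
  have hne : (𝓝[{p : ℂ | 0 < p.im}] (x : ℂ)).NeBot := by
    rw [← mem_closure_iff_nhdsWithin_neBot, closure_setOfPred_lt_im]
    simp
  refine tendsto_nhds_unique hFt (hFt'.congr' ?_)
  have h4 : ∀ᶠ p : ℂ in 𝓝 (x : ℂ), x - min ε ε' < p.re :=
    continuous_re.continuousAt.eventually (lt_mem_nhds (by simpa using hm))
  filter_upwards [nhdsWithin_le_nhds h4, self_mem_nhdsWithin] with p hp hp'
  exact (hEq ⟨hp', hp⟩).symm

theorem laplace_eq_of_isLaplaceContinuation {φ : ℝ → ℂ} {x : ℝ} {L : ℂ}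
    (hx : ¬ LaplaceConverges φ x) (h : IsLaplaceContinuation φ x L) : laplace φ x = L := by
  have hex : ∃ L, IsLaplaceContinuation φ x L := ⟨L, h⟩
  rw [laplace, if_neg hx, dif_pos hex]
  exact hex.choose_spec.unique h

theorem exp_mul_testFunction {N : ℕ} (s p : ℂ) :
    (fun t : ℝ => cexp (-(p * t)) * testFunction N s 0 t) = (Ici (1 / √(N : ℝ))).indicator
      fun t : ℝ => (N : ℂ) ^ (s / 2) * (cexp (-p * t) * (t : ℂ) ^ (s - 1)) := by
  funext t
  rw [testFunction]
  by_cases h : t ∈ Ici (1 / √(N : ℝ))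
  · rw [indicator_of_mem h, indicator_of_mem h]
    simp
    ring
  · rw [indicator_of_notMem h, indicator_of_notMem h, mul_zero]

section TestFunction

variable {N : ℕ} [NeZero N]

theorem sqrt_level_pos (N : ℕ) [NeZero N] : 0 < √(N : ℝ) :=
  Real.sqrt_pos.mpr (Nat.cast_pos.mpr (Nat.pos_of_ne_zero (NeZero.ne N)))

theorem Ici_inter_Ioi_zero : Ici (1 / √(N : ℝ)) ∩ Ioi 0 = Ici (1 / √(N : ℝ)) :=
  inter_eq_left.2 fun _ ht => (one_div_pos.2 (sqrt_level_pos N)).trans_le ht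

theorem laplaceConverges_testFunction_iff (s p : ℂ) :
    LaplaceConverges (testFunction N s 0) p ↔ IntegrableOn
      (fun t : ℝ => (N : ℂ) ^ (s / 2) * (cexp (-p * t) * (t : ℂ) ^ (s - 1)))
      (Ioi (1 / √(N : ℝ))) := by
  rw [LaplaceConverges, exp_mul_testFunction, IntegrableOn,
    integrable_indicator_iff measurableSet_Ici, IntegrableOn,
    Measure.restrict_restrict measurableSet_Ici, Ici_inter_Ioi_zero]
  exact integrableOn_Ici_iff_integrableOn_Ioi

theorem laplaceConverges_testFunction (s : ℂ) {p : ℂ} (hp : 0 < p.re) :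
    LaplaceConverges (testFunction N s 0) p :=
  (laplaceConverges_testFunction_iff s p).2
    ((integrableOn_exp_neg_mul_mul_cpow hp s (one_div_pos.2 (sqrt_level_pos N))).const_mul _)

/-- Exponential growth beats any power, so the integrand eventually has norm at least 1. At negative
points `laplace` is therefore given by the continuation. -/
theorem not_laplaceConverges_testFunction (s : ℂ) {x : ℝ} (hx : x < 0) :
    ¬ LaplaceConverges (testFunction N s 0) x := by
  rw [laplaceConverges_testFunction_iff]
  intro h
  have hN : (N : ℂ) ^ (s / 2) ≠ 0 := by
    rw [cpow_ne_zero_iff]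
    exact Or.inl (Nat.cast_ne_zero.2 (NeZero.ne N))
  have h1 : IntegrableOn (fun t : ℝ => cexp (-x * t) * (t : ℂ) ^ (s - 1))
      (Ioi (1 / √(N : ℝ))) := by
    refine (h.const_mul ((N : ℂ) ^ (s / 2))⁻¹).congr (Eventually.of_forall fun t => ?_)
    simp only
    rw [inv_mul_cancel_left₀ hN]
  have ht : Tendsto (fun t : ℝ => Real.exp (-x * t) / t ^ (1 - s.re)) atTop atTop :=
    tendsto_exp_mul_div_rpow_atTop (1 - s.re) (-x) (by linarith)
  obtain ⟨T, hT⟩ := eventually_atTop.1 (ht.eventually_ge_atTop 1)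
  set T' := max T (1 / √(N : ℝ))
  have h2 : IntegrableOn (fun _ : ℝ => (1 : ℝ)) (Ioi T') := by
    refine Integrable.mono' (h1.mono_set (Ioi_subset_Ioi (le_max_right T _))).norm
      aestronglyMeasurable_const ?_
    filter_upwards [ae_restrict_mem measurableSet_Ioi] with t ht
    have ht0 : 0 < t := (one_div_pos.2 (sqrt_level_pos N)).trans ((le_max_right T _).trans_lt ht)
    have h3 := hT t ((le_max_left T _).trans ht.le)
    rw [norm_one, norm_mul, norm_exp, norm_cpow_eq_rpow_re_of_pos ht0]
    refine h3.trans (le_of_eq ?_)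
    rw [div_eq_mul_inv, ← Real.rpow_neg ht0.le]
    simp
  rw [integrableOn_const_iff] at h2
  simp at h2

/-- The normalisation N^{s/2} is exactly what cancels the power of 1/√N arising from the
substitution in `laplaceIntegral_testFunction`. -/
theorem level_cpow_mul_cpow (s : ℂ) :
    (N : ℂ) ^ (s / 2) * (((1 / √(N : ℝ) : ℝ) : ℂ) ^ s) = 1 := by
  have hN0 : (0 : ℝ) < N := Nat.cast_pos.2 (Nat.pos_of_ne_zero (NeZero.ne N))
  have ha := one_div_pos.2 (sqrt_level_pos N)
  rw [cpow_def_of_ne_zero (Nat.cast_ne_zero.2 (NeZero.ne N)),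
    cpow_def_of_ne_zero (ofReal_ne_zero.2 ha.ne'), ← Complex.exp_add, ← ofReal_log ha.le,
    ← natCast_log, one_div, Real.log_inv, Real.log_sqrt hN0.le]
  push_cast
  ring_nf
  simp

theorem laplaceIntegral_testFunction (s p : ℂ) :
    laplaceIntegral (testFunction N s 0) p =
      ∫ t in Ioi (1 : ℝ), cexp (-(p * ((1 / √(N : ℝ) : ℝ) : ℂ)) * t) * (t : ℂ) ^ (s - 1) := by
  have ha := one_div_pos.2 (sqrt_level_pos N)
  rw [laplaceIntegral, exp_mul_testFunction, integral_indicator measurableSet_Ici,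
    Measure.restrict_restrict measurableSet_Ici, Ici_inter_Ioi_zero, integral_Ici_eq_integral_Ioi]
  have h := integral_comp_mul_left_Ioi
    (fun t : ℝ => (N : ℂ) ^ (s / 2) * (cexp (-p * t) * (t : ℂ) ^ (s - 1))) 1 ha
  rw [mul_one, eq_inv_smul_iff₀ ha.ne'] at h
  rw [← h, ← integral_smul]
  refine setIntegral_congr_fun measurableSet_Ioi fun t ht => ?_
  have ht0 : (0 : ℝ) < t := one_pos.trans ht
  have h1 := level_cpow_mul_cpow (N := N) s
  set a : ℝ := 1 / √(N : ℝ)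
  have ha0 : (a : ℂ) ≠ 0 := ofReal_ne_zero.2 ha.ne'
  simp only [real_smul, ofReal_mul]
  rw [mul_cpow_ofReal_nonneg ha.le ht0.le, cpow_sub _ _ ha0, cpow_one,
    show -(p * (a : ℂ)) * t = -p * (a * t) by ring]
  have h2 : (a : ℂ) * ((a : ℂ) ^ s / a) = (a : ℂ) ^ s := by field_simp
  linear_combination (cexp (-p * (a * t)) * (t : ℂ) ^ (s - 1)) * h1 +
    (N : ℂ) ^ (s / 2) * (cexp (-p * (a * t)) * (t : ℂ) ^ (s - 1)) * h2

theorem isLaplaceContinuation_testFunction {s : ℂ} {k : ℕ} (hs : s.re < k) {x : ℝ} (hx : x ≠ 0) :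
    IsLaplaceContinuation (testFunction N s 0) x
      (-I * cexp (-(x * (1 / √(N : ℝ)) : ℝ)) * oscExtension k s ((x * (1 / √(N : ℝ)) : ℝ))) := by
  have ha := one_div_pos.2 (sqrt_level_pos N)
  set a : ℝ := 1 / √(N : ℝ)
  -- Any positive abscissa and any positive ε would do, since the rotated integral is holomorphic on
  -- the full upper half-plane.
  refine ⟨1, 1, fun p => -I * cexp (-(p * a)) * oscExtension k s (p * a), one_pos, ?_, ?_, ?_, ?_⟩
  · intro p hp
    exact laplaceConverges_testFunction s (one_pos.trans_le hp)
  · have h : DifferentiableOn ℂ (fun p : ℂ => oscIntegral s (p * a)) {p : ℂ | 0 < p.im} := by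
      refine (differentiableOn_oscIntegral s).comp (f := fun p : ℂ => p * a) (by fun_prop) ?_
      intro p hp
      have hp' : 0 < p.im := hp
      change 0 < (p * (a : ℂ)).im
      simpa using mul_pos hp' ha
    refine (DifferentiableOn.mul (by fun_prop) (h.congr ?_)).mono fun p hp => hp.1
    intro p hp
    have hp' : 0 < p.im := hp
    exact oscExtension_eq_oscIntegral k s (by simpa using mul_pos hp' ha)
  · intro p hp _ hp1
    have h1 : 0 < (p * (a : ℂ)).re := by simpa using mul_pos (one_pos.trans_le hp1) ha
    have h2 : 0 < (p * (a : ℂ)).im := by simpa using mul_pos hp ha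
    simp only
    rw [laplaceIntegral_testFunction, oscExtension_eq_oscIntegral k s h2,
      integral_Ioi_eq_oscIntegral h1 h2]
  · have hlim : Tendsto (fun p : ℂ => p * a) (𝓝[{p : ℂ | 0 < p.im}] (x : ℂ))
        (𝓝 ((x * a : ℝ) : ℂ)) := by
      have h : Continuous fun p : ℂ => p * a := by fun_prop
      have := (h.tendsto (x : ℂ)).mono_left (nhdsWithin_le_nhds (s := {p : ℂ | 0 < p.im}))
      rwa [← ofReal_mul] at this
    have hxa : ((x * a : ℝ) : ℂ) ≠ 0 := ofReal_ne_zero.2 (mul_ne_zero hx ha.ne')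
    refine (hlim.neg.cexp.const_mul (-I)).mul ?_
    have h := continuousOn_oscExtension k (s, ((x * a : ℝ) : ℂ)) ⟨hs, by simp, hxa⟩
    refine h.tendsto.comp (f := fun p : ℂ => (s, p * (a : ℂ))) ?_
    refine tendsto_nhdsWithin_iff.2 ⟨tendsto_const_nhds.prodMk_nhds hlim, ?_⟩
    filter_upwards [self_mem_nhdsWithin] with p hp
    have hp' : 0 < p.im := hp
    refine ⟨hs, by simpa using (mul_pos hp' ha).le, fun h0 => ?_⟩
    have h3 : p * (a : ℂ) = 0 := h0
    have := congrArg im h3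
    simp at this
    rcases this with h | h
    · exact hp'.ne' h
    · exact ha.ne' h

theorem laplace_testFunction {s : ℂ} {k : ℕ} (hs : s.re < k) {x : ℝ} (hx : x ≠ 0) :
    laplace (testFunction N s 0) x =
      -I * cexp (-(x * (1 / √(N : ℝ)) : ℝ)) * oscExtension k s ((x * (1 / √(N : ℝ)) : ℝ)) := by
  rcases hx.lt_or_gt with h | h
  · exact laplace_eq_of_isLaplaceContinuation (not_laplaceConverges_testFunction s h)
      (isLaplaceContinuation_testFunction hs hx)
  · have ha := one_div_pos.2 (sqrt_level_pos N)
    rw [laplace, if_pos (laplaceConverges_testFunction s (by simpa using h)),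
      laplaceIntegral_testFunction, ← ofReal_mul,
      integral_Ioi_eq_oscExtension_of_pos (mul_pos h ha) hs]

end TestFunction

/-! ### The logarithm of the Gamma function -/

/-- The logarithm of `Complex.GammaSeq`, with principal branches for all factors. -/
def complexLogGammaSeq (z : ℂ) (M : ℕ) : ℂ :=
  z * (Real.log M : ℝ) + (Real.log (M.factorial : ℝ) : ℝ) -
    ∑ m ∈ Finset.range (M + 1), log (z + m)

theorem exp_complexLogGammaSeq {z : ℂ} (hz : 0 < z.im) {M : ℕ} (hM : M ≠ 0) :
    cexp (complexLogGammaSeq z M) = GammaSeq z M := by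
  have hM0 : (M : ℂ) ≠ 0 := Nat.cast_ne_zero.2 hM
  have h1 : cexp (z * (Real.log M : ℝ)) = (M : ℂ) ^ z := by
    rw [cpow_def_of_ne_zero hM0, mul_comm, natCast_log]
  have h2 : cexp ((Real.log (M.factorial : ℝ) : ℝ) : ℂ) = M.factorial := by
    rw [← ofReal_exp, Real.exp_log (Nat.cast_pos.2 M.factorial_pos), ofReal_natCast]
  have h3 : ∀ m : ℕ, z + m ≠ 0 := fun m h => by
    have := congrArg im h
    simp at this
    exact hz.ne' this
  rw [complexLogGammaSeq, Complex.exp_sub, Complex.exp_add, h1, h2, Complex.exp_sum, GammaSeq]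
  simp only [Complex.exp_log (h3 _)]

/-! ### Bounds on the imaginary part, fixing the branch -/

theorem arg_add_natCast_le {z : ℂ} (hx : 0 ≤ z.re) (hy : 0 < z.im) (m : ℕ) :
    arg (z + (m + 1 : ℕ)) ≤ z.im * ((m : ℝ) + 1)⁻¹ := by
  set w : ℂ := z + (m + 1 : ℕ)
  have hre : w.re = z.re + (m + 1) := by simp [w]
  have him : w.im = z.im := by simp [w]
  have hre0 : 0 < w.re := by rw [hre]; positivity
  have h0 : 0 ≤ arg w := arg_nonneg_iff.2 (by rw [him]; exact hy.le)
  have h1 : arg w < Real.pi / 2 := (abs_lt.1 (abs_arg_lt_pi_div_two_iff.2 (Or.inl hre0))).2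
  refine (Real.le_tan h0 h1).trans ?_
  rw [tan_arg, hre, him, div_eq_mul_inv]
  exact mul_le_mul_of_nonneg_left (inv_anti₀ (by positivity) (by linarith)) hy.le

/-- Here θ ≥ sin θ = im w / |w| with |w| ≤ m + 3; the upper bound `arg_add_natCast_le` uses θ ≤ tan
θ instead. Both compare the arguments with a harmonic sum, and hence with log M. -/
theorem le_arg_add_natCast {z : ℂ} (hx : 0 ≤ z.re) (hx1 : z.re ≤ 1) (hy : 0 < z.im)
    (hy1 : z.im ≤ 1) (m : ℕ) : z.im * ((m : ℝ) + 3)⁻¹ ≤ arg (z + (m + 1 : ℕ)) := by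
  set w : ℂ := z + (m + 1 : ℕ)
  have hre : w.re = z.re + (m + 1) := by simp [w]
  have him : w.im = z.im := by simp [w]
  have h0 : 0 ≤ arg w := arg_nonneg_iff.2 (by rw [him]; exact hy.le)
  have h2 : ‖w‖ ≤ (m : ℝ) + 3 := by
    refine (norm_le_abs_re_add_abs_im w).trans ?_
    rw [hre, him, abs_of_nonneg (by positivity), abs_of_pos hy]
    linarith
  have h3 : 0 < ‖w‖ := norm_pos_iff.2 fun h => by
    rw [h] at him
    exact hy.ne him
  refine le_trans ?_ (Real.sin_le h0)
  rw [sin_arg, him, div_eq_mul_inv]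
  gcongr

theorem sum_range_inv_eq_harmonic (M : ℕ) :
    ∑ m ∈ Finset.range M, ((m : ℝ) + 1)⁻¹ = (harmonic M : ℝ) := by
  simp [harmonic]

/-- The constant 3/2 = 1 + 1/2 is the pair of harmonic terms lost by starting at 1/3. -/
theorem log_le_sum_range_inv_add (M : ℕ) :
    Real.log M ≤ ∑ m ∈ Finset.range M, ((m : ℝ) + 3)⁻¹ + 3 / 2 := by
  have h1 := log_add_one_le_harmonic (M + 2)
  rw [← sum_range_inv_eq_harmonic, Finset.sum_range_succ', Finset.sum_range_succ'] at h1
  have h2 : Real.log M ≤ Real.log ((M + 2 : ℕ) + 1 : ℕ) := by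
    rcases Nat.eq_zero_or_pos M with rfl | h
    · simp only [Nat.cast_zero, Real.log_zero]
      exact Real.log_natCast_nonneg _
    · refine Real.log_le_log (Nat.cast_pos.2 h) (Nat.cast_le.2 (by omega))
  refine h2.trans (h1.trans (le_of_eq ?_))
  have h3 : ∀ m : ℕ, (((m + 1 + 1 : ℕ) : ℝ) + 1)⁻¹ = ((m : ℝ) + 3)⁻¹ := fun m => by
    push_cast
    ring
  simp only [h3]
  norm_num
  ring

theorem im_complexLogGammaSeq (z : ℂ) (M : ℕ) :
    (complexLogGammaSeq z M).im = z.im * Real.log M -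
      (∑ m ∈ Finset.range M, arg (z + (m + 1 : ℕ)) + arg z) := by
  rw [complexLogGammaSeq, Finset.sum_range_succ']
  simp [log_im, -natCast_log]

theorem im_complexLogGammaSeq_le {z : ℂ} (hx : 0 ≤ z.re) (hx1 : z.re ≤ 1) (hy : 0 < z.im)
    (hy1 : z.im ≤ 1) (M : ℕ) : (complexLogGammaSeq z M).im ≤ 3 / 2 := by
  rw [im_complexLogGammaSeq]
  have h1 : z.im * ∑ m ∈ Finset.range M, ((m : ℝ) + 3)⁻¹ ≤
      ∑ m ∈ Finset.range M, arg (z + (m + 1 : ℕ)) := by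
    rw [Finset.mul_sum]
    exact Finset.sum_le_sum fun m _ => le_arg_add_natCast hx hx1 hy hy1 m
  have h2 : 0 ≤ arg z := arg_nonneg_iff.2 hy.le
  have h3 := mul_le_mul_of_nonneg_left (log_le_sum_range_inv_add M) hy.le
  nlinarith

theorem le_im_complexLogGammaSeq {z : ℂ} (hx : 0 ≤ z.re) (hy : 0 < z.im)
    (hy1 : z.im ≤ 1) (M : ℕ) : -1 - Real.pi / 2 ≤ (complexLogGammaSeq z M).im := by
  rw [im_complexLogGammaSeq]
  have h1 : ∑ m ∈ Finset.range M, arg (z + (m + 1 : ℕ)) ≤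
      z.im * ∑ m ∈ Finset.range M, ((m : ℝ) + 1)⁻¹ := by
    rw [Finset.mul_sum]
    exact Finset.sum_le_sum fun m _ => arg_add_natCast_le hx hy m
  have h2 : arg z ≤ Real.pi / 2 := (abs_le.1 (abs_arg_le_pi_div_two_iff.2 hx)).2
  have h3 := harmonic_le_one_add_log M
  rw [← sum_range_inv_eq_harmonic] at h3
  have h4 := mul_le_mul_of_nonneg_left h3 hy.le
  nlinarith

/-! ### Convergence to the principal logarithm of Γ -/

/-- Mean value inequality on a half-disc: the derivative -z/(1 + z) has norm at most |w| there,
since |1 + z| ≥ 1. No smallness of w is needed. -/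
theorem norm_log_one_add_sub_self_le_sq {w : ℂ} (hw : 0 ≤ w.re) :
    ‖log (1 + w) - w‖ ≤ ‖w‖ ^ 2 := by
  have hconv : Convex ℝ (Metric.closedBall (0 : ℂ) ‖w‖ ∩ {z : ℂ | 0 ≤ z.re}) :=
    (convex_closedBall _ _).inter (convex_halfSpace_re_ge 0)
  have hd : ∀ z ∈ Metric.closedBall (0 : ℂ) ‖w‖ ∩ {z : ℂ | 0 ≤ z.re},
      HasDerivWithinAt (fun z : ℂ => log (1 + z) - z) (1 / (1 + z) - 1)
        (Metric.closedBall (0 : ℂ) ‖w‖ ∩ {z : ℂ | 0 ≤ z.re}) z := by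
    rintro z ⟨-, hz⟩
    have hz' : 0 ≤ z.re := hz
    have hs : 1 + z ∈ slitPlane := Or.inl (by simp; linarith)
    exact ((((hasDerivAt_id z).const_add 1).clog hs).sub (hasDerivAt_id z)).hasDerivWithinAt
  have hb : ∀ z ∈ Metric.closedBall (0 : ℂ) ‖w‖ ∩ {z : ℂ | 0 ≤ z.re},
      ‖1 / (1 + z) - 1‖ ≤ ‖w‖ := by
    rintro z ⟨hzw, hz⟩
    have hz' : 0 ≤ z.re := hz
    have h1 : 1 ≤ ‖1 + z‖ := by
      refine le_trans ?_ (re_le_norm _)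
      simp [hz']
    have h2 : 1 + z ≠ 0 := norm_pos_iff.1 (one_pos.trans_le h1)
    have h3 : 1 / (1 + z) - 1 = -z / (1 + z) := by field_simp; ring
    rw [h3, norm_div, norm_neg]
    exact (div_le_self (norm_nonneg _) h1).trans (by simpa using hzw)
  have h := hconv.norm_image_sub_le_of_norm_hasDerivWithin_le hd hb
    (x := 0) (y := w) ⟨by simp, by simp⟩ ⟨by simp, hw⟩
  simpa [sq] using h

theorem complexLogGammaSeq_succ_sub {z : ℂ} (hy : 0 < z.im) {M : ℕ} (hM : M ≠ 0) :
    complexLogGammaSeq z (M + 1) - complexLogGammaSeq z M =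
      z * log (1 + (1 / M : ℝ)) - log (1 + z / ((M + 1 : ℕ) : ℝ)) := by
  have hM0 : (0 : ℝ) < M := Nat.cast_pos.2 (Nat.pos_of_ne_zero hM)
  have hM1 : (0 : ℝ) < (M + 1 : ℕ) := Nat.cast_pos.2 M.succ_pos
  have hM1' : (((M + 1 : ℕ) : ℝ) : ℂ) ≠ 0 := ofReal_ne_zero.2 hM1.ne'
  have h1 : (1 : ℂ) + (1 / M : ℝ) = ((1 + 1 / M : ℝ) : ℂ) := by push_cast; ring
  have h2 : Real.log (1 + 1 / M) = Real.log (M + 1 : ℕ) - Real.log M := by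
    rw [← Real.log_div hM1.ne' hM0.ne']
    congr 1
    push_cast
    field_simp
  have h3 : log (z + (M + 1 : ℕ)) = (Real.log (M + 1 : ℕ) : ℝ) +
      log (1 + z / ((M + 1 : ℕ) : ℝ)) := by
    rw [← log_ofReal_mul hM1]
    · congr 1
      field_simp
      push_cast
      ring
    · intro h
      have : ((M + 1 : ℕ) : ℝ) * (1 + z / ((M + 1 : ℕ) : ℝ)) = (0 : ℂ) := by rw [h, mul_zero]
      rw [mul_add, mul_div_cancel₀ _ hM1'] at this
      have h4 := congrArg im this
      simp at h4
      exact hy.ne' h4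
  have h5 : Real.log ((M + 1).factorial : ℝ) = Real.log (M + 1 : ℕ) + Real.log M.factorial := by
    rw [Nat.factorial_succ, Nat.cast_mul, Real.log_mul hM1.ne'
      (Nat.cast_ne_zero.2 M.factorial_ne_zero)]
  rw [complexLogGammaSeq, complexLogGammaSeq, Finset.sum_range_succ _ (M + 1), h3, h1,
    ← ofReal_log (by positivity), h2, h5]
  push_cast
  ring

theorem norm_complexLogGammaSeq_succ_sub_le {z : ℂ} (hx : 0 ≤ z.re) (hy : 0 < z.im) {M : ℕ}
    (hM : M ≠ 0) : ‖complexLogGammaSeq z (M + 1) - complexLogGammaSeq z M‖ ≤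
      (2 * ‖z‖ + ‖z‖ ^ 2) * (1 / (M : ℝ) ^ 2) := by
  have hM0 : (0 : ℝ) < M := Nat.cast_pos.2 (Nat.pos_of_ne_zero hM)
  have hM1 : (0 : ℝ) < (M + 1 : ℕ) := Nat.cast_pos.2 M.succ_pos
  have hM0' : (M : ℂ) ≠ 0 := Nat.cast_ne_zero.2 hM
  have hM1' : (M : ℂ) + 1 ≠ 0 := by exact_mod_cast hM1.ne'
  rw [complexLogGammaSeq_succ_sub hy hM]
  have h1 := norm_log_one_add_sub_self_le_sq (w := (1 / M : ℝ)) (by rw [ofReal_re]; positivity)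
  have h2 := norm_log_one_add_sub_self_le_sq (w := z / ((M + 1 : ℕ) : ℝ))
    (by rw [div_ofReal_re]; positivity)
  -- The linear terms z/M and z/(M + 1) nearly cancel, leaving z/(M(M + 1)); every remaining term is
  -- quadratic in 1/M.
  have h3 : z * log (1 + (1 / M : ℝ)) - log (1 + z / ((M + 1 : ℕ) : ℝ)) =
      z * (log (1 + (1 / M : ℝ)) - (1 / M : ℝ)) -
        (log (1 + z / ((M + 1 : ℕ) : ℝ)) - z / ((M + 1 : ℕ) : ℝ)) +
        z * ((1 / (M * (M + 1)) : ℝ) : ℂ) := by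
    push_cast
    field_simp
    ring
  rw [h3]
  refine (norm_add_le _ _).trans ?_
  refine (add_le_add_left (norm_sub_le _ _) _).trans ?_
  rw [norm_mul, norm_mul, norm_real, Real.norm_of_nonneg (by positivity)]
  rw [norm_real, Real.norm_of_nonneg (by positivity)] at h1
  rw [norm_div, norm_real, Real.norm_of_nonneg hM1.le] at h2
  have h4 : (‖z‖ / (M + 1 : ℕ)) ^ 2 ≤ (‖z‖ / M) ^ 2 := by
    gcongr
    linarith
  have h5 : (1 / (M * (M + 1)) : ℝ) ≤ 1 / (M : ℝ) ^ 2 := by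
    gcongr
    nlinarith
  calc _ ≤ ‖z‖ * (1 / M) ^ 2 + (‖z‖ / M) ^ 2 + ‖z‖ * (1 / (M : ℝ) ^ 2) := by
        gcongr
        exact h2.trans h4
    _ = _ := by
      field_simp
      ring

theorem summable_one_div_succ_sq : Summable fun j : ℕ => 1 / ((j + 1 : ℕ) : ℝ) ^ 2 :=
  (summable_nat_add_iff 1).2 (Real.summable_one_div_nat_pow.2 one_lt_two)

/-- Summing the increments gives a bound independent of M, later the majorant for passing to the
limit under the integral. -/
theorem norm_complexLogGammaSeq_le {z : ℂ} (hx : 0 ≤ z.re) (hy : 0 < z.im) (M : ℕ) :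
    ‖complexLogGammaSeq z (M + 1)‖ ≤ ‖complexLogGammaSeq z 1‖ +
      (2 * ‖z‖ + ‖z‖ ^ 2) * ∑' j : ℕ, 1 / ((j + 1 : ℕ) : ℝ) ^ 2 := by
  have h1 : complexLogGammaSeq z (M + 1) = complexLogGammaSeq z 1 + ∑ j ∈ Finset.range M,
      (complexLogGammaSeq z (j + 1 + 1) - complexLogGammaSeq z (j + 1)) := by
    rw [Finset.sum_range_sub (fun j => complexLogGammaSeq z (j + 1))]
    ring
  rw [h1]
  refine (norm_add_le _ _).trans (add_le_add_right ?_ _)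
  refine (norm_sum_le_of_le _ fun j _ =>
    norm_complexLogGammaSeq_succ_sub_le hx hy j.succ_ne_zero).trans ?_
  rw [← Finset.mul_sum]
  refine mul_le_mul_of_nonneg_left ?_ (by positivity)
  exact summable_one_div_succ_sq.sum_le_tsum _ fun j _ => by positivity

theorem tendsto_complexLogGammaSeq {z : ℂ} (hx : 0 ≤ z.re) (hx1 : z.re ≤ 1) (hy : 0 < z.im)
    (hy1 : z.im ≤ 1) :
    Tendsto (complexLogGammaSeq z) atTop (𝓝 (log (Gamma z))) ∧ (log (Gamma z)).im ≤ 3 / 2 := by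
  have hc : CauchySeq fun j : ℕ => complexLogGammaSeq z (j + 1) := by
    refine cauchySeq_of_dist_le_of_summable _ (fun j => ?_)
      (summable_one_div_succ_sq.mul_left (2 * ‖z‖ + ‖z‖ ^ 2))
    rw [dist_comm, dist_eq_norm]
    exact norm_complexLogGammaSeq_succ_sub_le hx hy j.succ_ne_zero
  obtain ⟨l, hl⟩ := cauchySeq_tendsto_of_complete hc
  have hl' : Tendsto (complexLogGammaSeq z) atTop (𝓝 l) := (tendsto_add_atTop_iff_nat 1).1 hl
  have hexp : cexp l = Gamma z := by
    refine tendsto_nhds_unique (hl'.cexp) ((GammaSeq_tendsto_Gamma z).congr' ?_)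
    filter_upwards [eventually_ne_atTop 0] with M hM
    exact (exp_complexLogGammaSeq hy hM).symm
  have him := (continuous_im.tendsto l).comp hl'
  have h1 : l.im ≤ 3 / 2 :=
    le_of_tendsto' him fun M => im_complexLogGammaSeq_le hx hx1 hy hy1 M
  have h2 : -1 - Real.pi / 2 ≤ l.im :=
    ge_of_tendsto' him fun M => le_im_complexLogGammaSeq hx hy hy1 M
  -- The limit has imaginary part in [-1 - π/2, 3/2], inside (-π, π), so it is the principal
  -- logarithm of its exponential.
  have hlog : log (Gamma z) = l := by
    rw [← hexp, log_exp (by linarith [Real.pi_gt_three]) (by linarith [Real.pi_gt_three])]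
  rw [hlog]
  exact ⟨hl', h1⟩

theorem Gamma_mem_slitPlane {z : ℂ} (hx : 0 ≤ z.re) (hx1 : z.re ≤ 1) (hy : 0 < z.im)
    (hy1 : z.im ≤ 1) : Gamma z ∈ slitPlane := by
  rw [mem_slitPlane_iff_arg]
  refine ⟨fun h => ?_, Gamma_ne_zero fun m h => ?_⟩
  · have h1 := (tendsto_complexLogGammaSeq hx hx1 hy hy1).2
    rw [log_im, h] at h1
    linarith [Real.pi_gt_three]
  · rw [h] at hy
    simp at hy

theorem continuousOn_log_Gamma_segment {a : ℝ} (ha : 0 < a) (ha1 : a ≤ 1) :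
    ContinuousOn (fun x : ℝ => log (Gamma (x + a * I))) (Icc 0 1) := by
  intro x hx
  have h1 : DifferentiableAt ℂ Gamma (x + a * I) := differentiableAt_Gamma _ fun m h => by
    have := congrArg im h
    simp at this
    exact ha.ne' this
  have h2 : Gamma (x + a * I) ∈ slitPlane :=
    Gamma_mem_slitPlane (by simpa using hx.1) (by simpa using hx.2) (by simpa using ha)
      (by simpa using ha1)
  refine ContinuousAt.continuousWithinAt (ContinuousAt.clog ?_ h2)
  exact ContinuousAt.comp (f := fun x : ℝ => (x : ℂ) + a * I) (g := Gamma) h1.continuousAt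
    (by fun_prop)

/-! ### Fourier coefficients of the logarithm of the Gamma function on a segment -/

theorem integral_exp_mul_by_parts {κ : ℂ} (hκ : κ ≠ 0) {g g' : ℝ → ℂ} {T : ℝ}
    (hg : ∀ x, HasDerivAt g (g' x) x) (hg' : Continuous g') :
    ∫ x in (0 : ℝ)..T, cexp (κ * x) * g x =
      (cexp (κ * T) * g T - g 0) / κ - (∫ x in (0 : ℝ)..T, cexp (κ * x) * g' x) / κ := by
  have h1 : ∀ x : ℝ, HasDerivAt (fun x : ℝ => cexp (κ * x) / κ) (cexp (κ * x)) x := by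
    intro x
    have h := (((ofRealCLM.hasDerivAt (x := x)).const_mul κ).cexp).div_const κ
    convert! h using 1
    simp
    field_simp
  have h := intervalIntegral.integral_mul_deriv_eq_deriv_mul (a := 0) (b := T)
    (fun x _ => hg x) (fun x _ => h1 x) (hg'.intervalIntegrable _ _)
    (Continuous.intervalIntegrable (by fun_prop) _ _)
  have h2 : ∀ x : ℝ, cexp (κ * x) * g x = g x * cexp (κ * x) := fun x => mul_comm _ _
  have h3 : ∀ x : ℝ, g' x * (cexp (κ * x) / κ) = cexp (κ * x) * g' x / κ := fun x => by ring
  simp only [h2]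
  rw [h]
  simp only [h3]
  rw [intervalIntegral.integral_div]
  simp
  ring

section Segment

variable {κ : ℂ} {a : ℝ}

theorem add_mul_I_mem_slitPlane (ha : 0 < a) (x : ℝ) : (x : ℂ) + a * I ∈ slitPlane := by
  right
  simpa using ha.ne'

/-- Integrating by parts twice leaves an integrand of size x⁻², so that T can tend to infinity. -/
theorem integral_exp_mul_log (hκ : κ ≠ 0) (ha : 0 < a) (T : ℝ) :
    ∫ x in (0 : ℝ)..T, cexp (κ * x) * log (x + a * I) =
      (cexp (κ * T) * log (T + a * I) - log (a * I)) / κ -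
        ((cexp (κ * T) * (T + a * I)⁻¹ - (a * I)⁻¹) / κ +
          (∫ x in (0 : ℝ)..T, cexp (κ * x) * ((x + a * I) ^ 2)⁻¹) / κ) / κ := by
  have hd : ∀ x : ℝ, HasDerivAt (fun x : ℝ => (x : ℂ) + a * I) 1 x := fun x => by
    simpa using (ofRealCLM.hasDerivAt (x := x)).add_const ((a : ℂ) * I)
  have hne : ∀ x : ℝ, (x : ℂ) + a * I ≠ 0 := fun x =>
    slitPlane_ne_zero (add_mul_I_mem_slitPlane ha x)
  have h1 := integral_exp_mul_by_parts (T := T) hκ (g := fun x : ℝ => log (x + a * I))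
    (g' := fun x : ℝ => ((x : ℂ) + a * I)⁻¹)
    (fun x => by simpa using (hd x).clog_real (add_mul_I_mem_slitPlane ha x))
    (Continuous.inv₀ (by fun_prop) hne)
  have h2 := integral_exp_mul_by_parts (T := T) hκ (g := fun x : ℝ => ((x : ℂ) + a * I)⁻¹)
    (g' := fun x : ℝ => -(((x : ℂ) + a * I) ^ 2)⁻¹)
    (fun x => by simpa [neg_div] using (hd x).fun_inv (hne x))
    (Continuous.neg (Continuous.inv₀ (by fun_prop) fun x => pow_ne_zero 2 (hne x)))
  rw [h1, h2]
  simp only [mul_neg, intervalIntegral.integral_neg, ofReal_zero, zero_add]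
  ring

theorem exp_mul_natCast (h1 : cexp κ = 1) (m : ℕ) : cexp (κ * m) = 1 := by
  rw [mul_comm, Complex.exp_nat_mul, h1, one_pow]

theorem integral_exp_eq_zero (hκ : κ ≠ 0) (h1 : cexp κ = 1) :
    ∫ x in (0 : ℝ)..1, cexp (κ * x) = 0 := by
  rw [integral_exp_mul_complex hκ]
  simp [h1]

theorem integral_exp_mul_self (hκ : κ ≠ 0) (h1 : cexp κ = 1) :
    ∫ x in (0 : ℝ)..1, cexp (κ * x) * x = 1 / κ := by
  have h := integral_exp_mul_by_parts (T := 1) hκ (g := fun x : ℝ => (x : ℂ))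
    (g' := fun _ => ofRealCLM 1) (fun x => ofRealCLM.hasDerivAt (x := x))
    continuous_const
  rw [h]
  simp [h1, integral_exp_eq_zero hκ h1]

/-- The exponential has period 1, so shifting the m-th integral by m makes the unit intervals
adjacent. -/
theorem sum_integral_exp_mul_log (h1 : cexp κ = 1) (ha : 0 < a) (n : ℕ) :
    ∑ m ∈ Finset.range n, ∫ x in (0 : ℝ)..1, cexp (κ * x) * log (x + a * I + m) =
      ∫ x in (0 : ℝ)..n, cexp (κ * x) * log (x + a * I) := by
  have hc : Continuous fun x : ℝ => cexp (κ * x) * log (x + a * I) :=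
    Continuous.mul (by fun_prop) (Continuous.clog (by fun_prop) (add_mul_I_mem_slitPlane ha))
  have h := intervalIntegral.sum_integral_adjacent_intervals (μ := volume)
    (f := fun x : ℝ => cexp (κ * x) * log (x + a * I)) (a := fun m : ℕ => (m : ℝ)) (n := n)
    (fun k _ => hc.intervalIntegrable _ _)
  rw [Nat.cast_zero] at h
  rw [← h]
  refine Finset.sum_congr rfl fun m _ => ?_
  have h2 := intervalIntegral.integral_comp_add_right (a := 0) (b := 1)
    (fun x : ℝ => cexp (κ * x) * log (x + a * I)) (m : ℝ)
  rw [zero_add, add_comm (1 : ℝ), ← Nat.cast_add_one] at h2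
  rw [← h2]
  refine intervalIntegral.integral_congr fun x _ => ?_
  rw [ofReal_add, mul_add, Complex.exp_add, ofReal_natCast, exp_mul_natCast h1, mul_one]
  congr 2
  ring

theorem continuous_complexLogGammaSeq (ha : 0 < a) (M : ℕ) :
    Continuous fun x : ℝ => complexLogGammaSeq (x + a * I) M := by
  unfold complexLogGammaSeq
  refine Continuous.sub (by fun_prop) (continuous_finsetSum _ fun m _ => ?_)
  refine Continuous.clog (by fun_prop) fun x => ?_
  right
  simpa using ha.ne'

/-- Constants integrate to zero against a nontrivial 1-periodic exponential; outside the sum of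
logarithms only x log M survives. Its contribution cancels the logarithmic growth at the upper end
of the glued integral, by `tendsto_log_natCast_sub_log`. -/
theorem integral_exp_mul_complexLogGammaSeq (hκ : κ ≠ 0) (h1 : cexp κ = 1) (ha : 0 < a) (M : ℕ) :
    ∫ x in (0 : ℝ)..1, cexp (κ * x) * complexLogGammaSeq (x + a * I) M =
      (Real.log M : ℝ) / κ -
        ∫ x in (0 : ℝ)..(M + 1 : ℕ), cexp (κ * x) * log (x + a * I) := by
  have hlog : ∀ m : ℕ, Continuous fun x : ℝ => log ((x : ℂ) + a * I + m) := fun m =>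
    Continuous.clog (by fun_prop) fun x => by
      right
      simpa using ha.ne'
  have hi : ∀ m : ℕ, IntervalIntegrable
      (fun x : ℝ => cexp (κ * x) * log ((x : ℂ) + a * I + m)) volume 0 1 := fun m =>
    (Continuous.mul (by fun_prop) (hlog m)).intervalIntegrable _ _
  have h2 : ∀ x : ℝ, cexp (κ * x) * complexLogGammaSeq (x + a * I) M =
      (cexp (κ * x) * x) * (Real.log M : ℝ) +
        cexp (κ * x) * (a * I * (Real.log M : ℝ) + (Real.log (M.factorial : ℝ) : ℝ)) -
        ∑ m ∈ Finset.range (M + 1), cexp (κ * x) * log (x + a * I + m) := by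
    intro x
    rw [complexLogGammaSeq, ← Finset.mul_sum]
    ring
  simp only [h2]
  rw [intervalIntegral.integral_sub, intervalIntegral.integral_add,
    intervalIntegral.integral_mul_const, intervalIntegral.integral_mul_const,
    integral_exp_eq_zero hκ h1, integral_exp_mul_self hκ h1, intervalIntegral.integral_finsetSum,
    sum_integral_exp_mul_log h1 ha]
  · ring
  · exact fun m _ => hi m
  · exact Continuous.intervalIntegrable (by fun_prop) _ _
  · exact Continuous.intervalIntegrable (by fun_prop) _ _
  · exact Continuous.intervalIntegrable (by fun_prop) _ _
  · exact Continuous.intervalIntegrable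
      (continuous_finsetSum _ fun m _ => Continuous.mul (by fun_prop) (hlog m)) _ _

theorem tendsto_log_natCast_sub_log (ha : 0 < a) :
    Tendsto (fun M : ℕ => (Real.log M : ℂ) - log (((M + 1 : ℕ) : ℝ) + a * I)) atTop (𝓝 0) := by
  have h0 : Tendsto (fun M : ℕ => ((1 / (M : ℝ) : ℝ) : ℂ)) atTop (𝓝 0) := by
    have := (continuous_ofReal.tendsto 0).comp (tendsto_one_div_atTop_nhds_zero_nat (𝕜 := ℝ))
    simpa [Function.comp_def] using this
  have h1 : Tendsto (fun M : ℕ => 1 + ((1 / (M : ℝ) : ℝ) : ℂ) * (1 + a * I)) atTop (𝓝 1) := by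
    simpa using (h0.mul_const (1 + a * I)).const_add 1
  have h2 := (h1.clog one_mem_slitPlane).neg
  rw [Complex.log_one, neg_zero] at h2
  refine h2.congr' ?_
  filter_upwards [eventually_gt_atTop 0] with M hM
  have hM0 : (0 : ℝ) < M := Nat.cast_pos.2 hM
  have hM0' : (M : ℂ) ≠ 0 := Nat.cast_ne_zero.2 hM.ne'
  have h3 : (((M + 1 : ℕ) : ℝ) + a * I : ℂ) =
      (M : ℝ) * (1 + ((1 / (M : ℝ) : ℝ) : ℂ) * (1 + a * I)) := by
    push_cast
    field_simp
    ring
  rw [h3, log_ofReal_mul hM0]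
  · ring
  · intro h
    rw [h, mul_zero] at h3
    exact slitPlane_ne_zero (add_mul_I_mem_slitPlane ha _) h3

end Segment

/-- With x = av one has x + ai = ai(1 - iv), and the exponent -2 corresponds to s = -1, where
`oscIntegral` converges on the real axis. -/
theorem integrableOn_exp_mul_inv_sq_and_integral_eq {a p : ℝ} (ha : 0 < a) :
    IntegrableOn (fun x : ℝ => cexp (I * p * x) * ((x + a * I) ^ 2)⁻¹) (Ioi 0) ∧
    ∫ x in Ioi (0 : ℝ), cexp (I * p * x) * ((x + a * I) ^ 2)⁻¹ =
      -oscIntegral (-1) ((p * a : ℝ)) / a := by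
  have ha0 : (a : ℂ) ≠ 0 := ofReal_ne_zero.2 ha.ne'
  have h1 : ∀ v : ℝ, cexp (I * p * (a * v : ℝ)) * (((a * v : ℝ) + a * I) ^ 2)⁻¹ =
      -(((a : ℂ) ^ 2)⁻¹ * (cexp (I * (p * a : ℝ) * v) * (1 - I * v) ^ ((-1 : ℂ) - 1))) := by
    intro v
    have h2 : (1 - I * (v : ℂ)) ^ ((-1 : ℂ) - 1) = ((1 - I * (v : ℂ)) ^ 2)⁻¹ := by
      rw [show (-1 : ℂ) - 1 = -(2 : ℕ) by norm_num, cpow_neg, cpow_natCast]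
    have h3 : (((a * v : ℝ) : ℂ) + a * I) ^ 2 = -((a : ℂ) ^ 2 * (1 - I * v) ^ 2) := by
      push_cast
      linear_combination (a ^ 2 * (1 + v ^ 2) : ℂ) * I_sq
    rw [h2, h3, inv_neg, mul_inv, show I * (p : ℂ) * (a * v : ℝ) = I * (p * a : ℝ) * v by
      push_cast; ring]
    ring
  have hint := integrableOn_osc (w := (-1 : ℂ) - 1) (q := ((p * a : ℝ) : ℂ)) (by simp)
    (Or.inl (by simp))
  constructor
  · rw [← mul_zero a, ← integrableOn_Ioi_comp_mul_left_iff _ _ ha]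
    simp only [h1]
    exact (hint.const_mul _).neg
  · have h := integral_comp_mul_left_Ioi
      (fun x : ℝ => cexp (I * p * x) * ((x + a * I) ^ 2)⁻¹) 0 ha
    rw [mul_zero, eq_inv_smul_iff₀ ha.ne'] at h
    rw [← h]
    simp only [h1]
    rw [integral_neg, integral_const_mul, real_smul]
    change (a : ℂ) * -(((a : ℂ) ^ 2)⁻¹ * oscIntegral (-1) _) = _
    field_simp

/-- The Fourier coefficients of `log Γ` along the segment from `a i` to `1 + a i`. -/
theorem integral_exp_mul_log_Gamma {a p : ℝ} (ha : 0 < a) (ha1 : a ≤ 1) (hp : p ≠ 0)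
    (h1 : cexp (I * p) = 1) :
    ∫ x in (0 : ℝ)..1, cexp (I * p * x) * log (Gamma (x + a * I)) =
      log (a * I) / (I * p) - (a / (p * a : ℝ)) * oscExtension 1 0 ((p * a : ℝ)) := by
  have hp0 : (p : ℂ) ≠ 0 := ofReal_ne_zero.2 hp
  have hκ : I * (p : ℂ) ≠ 0 := mul_ne_zero I_ne_zero hp0
  have ha0 : (a : ℂ) ≠ 0 := ofReal_ne_zero.2 ha.ne'
  have hlim1 : Tendsto (fun M : ℕ => ∫ x in (0 : ℝ)..1,
      cexp (I * p * x) * complexLogGammaSeq (x + a * I) (M + 1)) atTop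
      (𝓝 (∫ x in (0 : ℝ)..1, cexp (I * p * x) * log (Gamma (x + a * I)))) := by
    refine intervalIntegral.tendsto_integral_filter_of_dominated_convergence
      (fun x => ‖complexLogGammaSeq (x + a * I) 1‖ + (2 * ‖(x : ℂ) + a * I‖ +
        ‖(x : ℂ) + a * I‖ ^ 2) * ∑' j : ℕ, 1 / ((j + 1 : ℕ) : ℝ) ^ 2) ?_ ?_ ?_ ?_
    · exact Eventually.of_forall fun M => (Continuous.mul (by fun_prop)
        (continuous_complexLogGammaSeq ha _)).aestronglyMeasurable
    · refine Eventually.of_forall fun M => Eventually.of_forall fun x hx => ?_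
      rw [uIoc_of_le zero_le_one] at hx
      have h2 : ‖cexp (I * p * x)‖ = 1 := by
        rw [norm_exp]
        simp
      rw [norm_mul, h2, one_mul]
      exact norm_complexLogGammaSeq_le (by simpa using hx.1.le) (by simpa using ha) M
    · have := continuous_complexLogGammaSeq ha 1
      exact Continuous.intervalIntegrable (by fun_prop) _ _
    · refine Eventually.of_forall fun x hx => ?_
      rw [uIoc_of_le zero_le_one] at hx
      refine ((tendsto_add_atTop_iff_nat 1).2 (tendsto_complexLogGammaSeq ?_ ?_ ?_ ?_).1).const_mul _
      · simpa using hx.1.le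
      · simpa using hx.2
      · simpa using ha
      · simpa using ha1
  obtain ⟨hint, hval⟩ := integrableOn_exp_mul_inv_sq_and_integral_eq (p := p) ha
  have hcast : Tendsto (fun M : ℕ => ((M + 1 : ℕ) : ℝ)) atTop atTop :=
    (tendsto_natCast_atTop_atTop (R := ℝ)).comp (tendsto_add_atTop_nat 1)
  have hlim2 : Tendsto (fun M : ℕ => ∫ x in (0 : ℝ)..(M + 1 : ℕ),
      cexp (I * p * x) * ((x + a * I) ^ 2)⁻¹) atTop
      (𝓝 (-oscIntegral (-1) ((p * a : ℝ)) / a)) := by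
    rw [← hval]
    exact intervalIntegral_tendsto_integral_Ioi 0 hint hcast
  have hlim3 : Tendsto (fun M : ℕ => ((((M + 1 : ℕ) : ℝ) : ℂ) + a * I)⁻¹) atTop (𝓝 0) := by
    refine tendsto_inv₀_cobounded.comp (tendsto_norm_atTop_iff_cobounded.1 ?_)
    refine tendsto_atTop_mono (fun M => ?_) hcast
    refine le_trans ?_ (re_le_norm _)
    simp
  have hlim4 := ((tendsto_log_natCast_sub_log ha).add_const (log (a * I))).div_const (I * (p : ℂ))
  have hlim := hlim4.add ((((hlim3.sub_const ((a : ℂ) * I)⁻¹).div_const (I * (p : ℂ))).add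
    (hlim2.div_const (I * (p : ℂ)))).div_const (I * (p : ℂ)))
  have hlim1' := (tendsto_add_atTop_iff_nat (f := fun M : ℕ => ∫ x in (0 : ℝ)..1,
      cexp (I * p * x) * complexLogGammaSeq (x + a * I) M) 1).1 hlim1
  refine (tendsto_nhds_unique hlim1' (hlim.congr fun M => ?_)).trans ?_
  · rw [integral_exp_mul_complexLogGammaSeq hκ h1 ha, integral_exp_mul_log hκ ha,
      ofReal_natCast, exp_mul_natCast h1]
    ring
  · simp only [oscExtension, zero_sub, zero_add]
    push_cast
    field_simp
    ring_nf
    simp only [I_sq, I_pow_three, I_pow_four]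
    ring

/-- The Fourier coefficients of `log Γ(z) - log (a i) z` along the segment from `a i` to
`1 + a i`. -/
theorem integral_exp_mul_log_Gamma_add {a p : ℝ} (ha : 0 < a) (ha1 : a ≤ 1) (hp : p ≠ 0)
    (h1 : cexp (I * p) = 1) {C : ℂ} (hC : log (a * I) + C = 0) :
    ∫ x in (0 : ℝ)..1, cexp (I * p * x) * (log (Gamma (x + a * I)) + C * (x + a * I)) =
      -((a / (p * a : ℝ)) * oscExtension 1 0 ((p * a : ℝ))) := by
  have hp0 : (p : ℂ) ≠ 0 := ofReal_ne_zero.2 hp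
  have hκ : I * (p : ℂ) ≠ 0 := mul_ne_zero I_ne_zero hp0
  have h2 : ∀ x : ℝ, cexp (I * p * x) * (log (Gamma (x + a * I)) + C * (x + a * I)) =
      cexp (I * p * x) * log (Gamma (x + a * I)) +
        ((cexp (I * p * x) * x) * C + cexp (I * p * x) * (C * (a * I))) := fun x => by ring
  simp only [h2]
  rw [intervalIntegral.integral_add, intervalIntegral.integral_add,
    intervalIntegral.integral_mul_const, intervalIntegral.integral_mul_const,
    integral_exp_eq_zero hκ h1, integral_exp_mul_self hκ h1, integral_exp_mul_log_Gamma ha ha1 hp h1]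
  -- The linear term contributes C/(ip), which cancels log(ai)/(ip).
  · linear_combination hC / (I * p)
  · exact Continuous.intervalIntegrable (by fun_prop) _ _
  · exact Continuous.intervalIntegrable (by fun_prop) _ _
  · refine ContinuousOn.intervalIntegrable ?_
    rw [uIcc_of_le zero_le_one]
    exact ContinuousOn.mul (by fun_prop) (continuousOn_log_Gamma_segment ha ha1)
  · exact Continuous.intervalIntegrable (by fun_prop) _ _

/-! ### Fourier expansion of a periodic holomorphic function on the upper half-plane -/

theorem IsWeaklyHolomorphicModularForm.comp_ofComplex_add_one {N : ℕ} {k : ℤ} {f : ℍ → ℂ}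
    (hf : IsWeaklyHolomorphicModularForm N k f) (z : ℂ) :
    f (UpperHalfPlane.ofComplex (z + 1)) = f (UpperHalfPlane.ofComplex z) := by
  have hT : ModularGroup.T ∈ CongruenceSubgroup.Gamma0 N := by
    rw [CongruenceSubgroup.Gamma0_mem]
    simp [ModularGroup.T]
  let F : SlashInvariantForm (CongruenceSubgroup.Gamma0 N : Subgroup (GL (Fin 2) ℝ)) k :=
    { toFun := f
      slash_action_eq' := by
        rintro _ ⟨γ, hγ, rfl⟩
        exact hf.slash_eq γ hγ }
  have h1 : (1 : ℝ) ∈ (CongruenceSubgroup.Gamma0 N : Subgroup (GL (Fin 2) ℝ)).strictPeriods := by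
    rw [Subgroup.strictPeriods_eq_zmultiples_one_of_T_mem hT]
    exact AddSubgroup.mem_zmultiples 1
  have h := SlashInvariantFormClass.periodic_comp_ofComplex F h1 z
  rw [ofReal_one] at h
  exact h

theorem integral_horizontal_eq {h : ℂ → ℂ} (hd : DifferentiableOn ℂ h {z | 0 < z.im})
    (hp : ∀ z, h (z + 1) = h z) {y y' : ℝ} (hy : 0 < y) (hy' : 0 < y') :
    ∫ x in (0 : ℝ)..1, h (x + y * I) = ∫ x in (0 : ℝ)..1, h (x + y' * I) := by
  have hr := integral_boundary_rect_eq_zero_of_differentiableOn h (y * I) (1 + y' * I) ?_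
  · simp only [mul_re, ofReal_re, I_re, mul_zero, ofReal_im, I_im, mul_one, sub_self, add_re,
      one_re, add_zero, mul_im, add_im, one_im, zero_add, ofReal_one, ofReal_zero,
      smul_eq_mul] at hr
    simp only [add_comm (1 : ℂ), hp] at hr
    linear_combination hr
  · refine hd.mono fun z hz => ?_
    have h1 := hz.2
    simp only [mul_im, ofReal_re, I_im, mul_one, ofReal_im, I_re, mul_zero, add_zero, add_im,
      one_im, zero_add] at h1
    exact (lt_min hy hy').trans_le h1.1

section Expansion

variable {f : ℍ → ℂ}

theorem expansionCoeff_eq_integral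
    (hd : DifferentiableOn ℂ (f ∘ UpperHalfPlane.ofComplex) {z : ℂ | 0 < z.im})
    (hp : ∀ z, f (UpperHalfPlane.ofComplex (z + 1)) = f (UpperHalfPlane.ofComplex z))
    (n : ℤ) {y : ℝ} (hy : 0 < y) :
    expansionCoeff f n = ∫ x in (0 : ℝ)..1, f (UpperHalfPlane.ofComplex (x + y * I)) *
      cexp (-(2 * Real.pi * I * n * (x + y * I))) := by
  have h := integral_horizontal_eq (h := fun z => f (UpperHalfPlane.ofComplex z) *
    cexp (-(2 * Real.pi * I * n * z))) (hd.mul (by fun_prop)) (fun z => ?_) one_pos hy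
  · rw [← h]
    simp only [ofReal_one, one_mul]
    rfl
  · rw [hp, mul_add, neg_add, Complex.exp_add]
    have : cexp (-(2 * Real.pi * I * n * 1)) = 1 := by
      rw [exp_eq_one_iff]
      exact ⟨-n, by push_cast; ring⟩
    rw [this, mul_one]

theorem continuous_horizontal
    (hd : DifferentiableOn ℂ (f ∘ UpperHalfPlane.ofComplex) {z : ℂ | 0 < z.im})
    {y : ℝ} (hy : 0 < y) : Continuous fun x : ℝ => f (UpperHalfPlane.ofComplex (x + y * I)) :=
  hd.continuousOn.comp_continuous (f := fun x : ℝ => (x : ℂ) + y * I) (by fun_prop)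
    (fun x => by simpa using hy)

/-- The height y is free because the coefficient integral does not depend on it. -/
theorem exists_norm_expansionCoeff_le
    (hd : DifferentiableOn ℂ (f ∘ UpperHalfPlane.ofComplex) {z : ℂ | 0 < z.im})
    (hp : ∀ z, f (UpperHalfPlane.ofComplex (z + 1)) = f (UpperHalfPlane.ofComplex z))
    {y : ℝ} (hy : 0 < y) :
    ∃ C : ℝ, ∀ n : ℤ, ‖expansionCoeff f n‖ ≤ C * Real.exp (2 * Real.pi * n * y) := by
  obtain ⟨C, hC⟩ := isCompact_Icc.exists_bound_of_continuousOn (s := Icc (0 : ℝ) 1)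
    (continuous_horizontal hd hy).continuousOn
  refine ⟨C, fun n => ?_⟩
  rw [expansionCoeff_eq_integral hd hp n hy]
  refine (intervalIntegral.norm_integral_le_of_norm_le_const
    (C := C * Real.exp (2 * Real.pi * n * y)) fun x hx => ?_).trans (by simp)
  rw [uIoc_of_le zero_le_one] at hx
  rw [norm_mul, norm_exp]
  have h1 : (-(2 * Real.pi * I * n * (x + y * I)) : ℂ).re = 2 * Real.pi * n * y := by
    simp
  rw [h1]
  exact mul_le_mul_of_nonneg_right (hC x ⟨hx.1.le, hx.2⟩) (Real.exp_pos _).le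

theorem summable_expansionCoeff_mul_exp
    (hd : DifferentiableOn ℂ (f ∘ UpperHalfPlane.ofComplex) {z : ℂ | 0 < z.im})
    (hp : ∀ z, f (UpperHalfPlane.ofComplex (z + 1)) = f (UpperHalfPlane.ofComplex z))
    {y : ℝ} (hy : 0 < y) :
    Summable fun n : ℤ => ‖expansionCoeff f n‖ * Real.exp (-(2 * Real.pi * n * y)) := by
  have hgeom : Summable fun n : ℕ => Real.exp (n * -(Real.pi * y)) :=
    Real.summable_exp_nat_mul_iff.2 (by have := mul_pos Real.pi_pos hy; linarith)
  -- A lower height y/2 serves n ≥ 0 and a higher one 3y/2 serves n ≤ 0; either way a geometric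
  -- factor e^{-π|n|y} remains.
  obtain ⟨C₁, h₁⟩ := exists_norm_expansionCoeff_le hd hp (half_pos hy)
  obtain ⟨C₂, h₂⟩ := exists_norm_expansionCoeff_le hd hp (show 0 < 3 / 2 * y by linarith)
  refine Summable.of_nat_of_neg ?_ ?_
  · refine Summable.of_nonneg_of_le (fun n => by positivity) (fun n => ?_) (hgeom.mul_left C₁)
    refine (mul_le_mul_of_nonneg_right (h₁ n) (Real.exp_pos _).le).trans (le_of_eq ?_)
    rw [mul_assoc, ← Real.exp_add]
    congr 2
    push_cast
    ring
  · refine Summable.of_nonneg_of_le (fun n => by positivity) (fun n => ?_) (hgeom.mul_left C₂)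
    refine (mul_le_mul_of_nonneg_right (h₂ (-n)) (Real.exp_pos _).le).trans (le_of_eq ?_)
    rw [mul_assoc, ← Real.exp_add]
    congr 2
    push_cast
    ring

/-- On a horizontal line f is a continuous function on the circle with absolutely summable Fourier
coefficients, so its Fourier series converges to it pointwise. -/
theorem hasSum_expansion
    (hd : DifferentiableOn ℂ (f ∘ UpperHalfPlane.ofComplex) {z : ℂ | 0 < z.im})
    (hp : ∀ z, f (UpperHalfPlane.ofComplex (z + 1)) = f (UpperHalfPlane.ofComplex z))
    {y : ℝ} (hy : 0 < y) (x : ℝ) :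
    HasSum (fun n : ℤ => expansionCoeff f n * cexp (2 * Real.pi * I * n * (x + y * I)))
      (f (UpperHalfPlane.ofComplex (x + y * I))) := by
  have hper : Function.Periodic (fun x : ℝ => f (UpperHalfPlane.ofComplex (x + y * I))) 1 := by
    intro x
    have h := hp (x + y * I)
    rw [add_right_comm] at h
    simpa using h
  let F : C(AddCircle (1 : ℝ), ℂ) := ⟨hper.lift, by
    refine isQuotientMap_quotient_mk'.continuous_iff.2 ?_
    exact continuous_horizontal hd hy⟩
  have hcoeff : ∀ n : ℤ, fourierCoeff F n =
      expansionCoeff f n * cexp (-(2 * Real.pi * n * y)) := by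
    intro n
    rw [fourierCoeff_eq_intervalIntegral F n 0, expansionCoeff_eq_integral hd hp n hy,
      ← intervalIntegral.integral_mul_const]
    simp only [zero_add, div_one, one_smul]
    refine intervalIntegral.integral_congr fun x _ => ?_
    change _ * f (UpperHalfPlane.ofComplex (x + y * I)) = _
    rw [fourier_coe_apply, mul_assoc (f _), ← Complex.exp_add, mul_comm]
    congr 2
    push_cast
    linear_combination (2 * Real.pi * n * y : ℂ) * I_sq
  have hsum : Summable (fourierCoeff F) := by
    refine Summable.of_norm ((summable_expansionCoeff_mul_exp hd hp hy).congr fun n => ?_)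
    rw [hcoeff, norm_mul, norm_exp]
    simp
  have h := has_pointwise_sum_fourier_series_of_summable hsum (x : AddCircle (1 : ℝ))
  refine (h.congr_fun fun n => ?_)
  rw [hcoeff, fourier_coe_apply, smul_eq_mul, mul_assoc (expansionCoeff f n), ← Complex.exp_add]
  congr 2
  push_cast
  linear_combination (2 * Real.pi * n * y : ℂ) * I_sq

theorem hasSum_integral_mul_expansion
    (hd : DifferentiableOn ℂ (f ∘ UpperHalfPlane.ofComplex) {z : ℂ | 0 < z.im})
    (hp : ∀ z, f (UpperHalfPlane.ofComplex (z + 1)) = f (UpperHalfPlane.ofComplex z))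
    {y : ℝ} (hy : 0 < y) {g : ℝ → ℂ} (hg : ContinuousOn g (Icc 0 1)) :
    HasSum (fun n : ℤ => expansionCoeff f n * cexp (-(2 * Real.pi * n * y)) *
        ∫ x in (0 : ℝ)..1, cexp (I * (2 * Real.pi * n : ℝ) * x) * g x)
      (∫ x in (0 : ℝ)..1, f (UpperHalfPlane.ofComplex (x + y * I)) * g x) := by
  have hs := summable_expansionCoeff_mul_exp hd hp hy
  have h1 : ∀ n : ℤ, expansionCoeff f n * cexp (-(2 * Real.pi * n * y)) *
      (∫ x in (0 : ℝ)..1, cexp (I * (2 * Real.pi * n : ℝ) * x) * g x) =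
      ∫ x in (0 : ℝ)..1, expansionCoeff f n * cexp (2 * Real.pi * I * n * (x + y * I)) * g x := by
    intro n
    rw [← intervalIntegral.integral_const_mul]
    refine intervalIntegral.integral_congr fun x _ => ?_
    rw [mul_assoc, ← mul_assoc (cexp _), ← Complex.exp_add, ← mul_assoc]
    congr 3
    push_cast
    linear_combination (-2 * Real.pi * n * y : ℂ) * I_sq
  simp only [h1]
  have hgm : AEStronglyMeasurable g (volume.restrict (uIoc (0 : ℝ) 1)) := by
    rw [uIoc_of_le zero_le_one]
    exact (hg.mono Ioc_subset_Icc_self).aestronglyMeasurable measurableSet_Ioc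
  refine intervalIntegral.hasSum_integral_of_dominated_convergence
    (fun n x => ‖expansionCoeff f n‖ * Real.exp (-(2 * Real.pi * n * y)) * ‖g x‖) ?_ ?_ ?_ ?_ ?_
  · intro n
    exact AEStronglyMeasurable.mul (Continuous.aestronglyMeasurable (by fun_prop)) hgm
  · refine fun n => Eventually.of_forall fun x _ => le_of_eq ?_
    rw [norm_mul, norm_mul, norm_exp]
    simp
  · exact Eventually.of_forall fun x _ => hs.mul_right _
  · simp only [tsum_mul_right]
    refine ContinuousOn.intervalIntegrable ?_
    rw [uIcc_of_le zero_le_one]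
    exact continuousOn_const.mul hg.norm
  · exact Eventually.of_forall fun x _ => (hasSum_expansion hd hp hy x).mul_right (g x)

end Expansion

/-! ### The derivative at the central point -/

section CentralDerivative

variable {N : ℕ} [NeZero N]

theorem two_pi_mul_intCast_ne_zero {n : ℤ} (hn : n ≠ 0) : 2 * Real.pi * n ≠ 0 :=
  mul_ne_zero Real.two_pi_pos.ne' (Int.cast_ne_zero.2 hn)

theorem two_pi_mul_le_norm {a : ℝ} (ha : 0 < a) {n : ℤ} (hn : n ≠ 0) :
    2 * Real.pi * a ≤ ‖((2 * Real.pi * n * a : ℝ) : ℂ)‖ := by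
  have h1 : (1 : ℝ) ≤ |(n : ℝ)| := by exact_mod_cast Int.one_le_abs hn
  have h2 := mul_pos Real.two_pi_pos ha
  rw [norm_real, Real.norm_eq_abs, abs_mul, abs_mul, abs_of_pos Real.two_pi_pos, abs_of_pos ha]
  nlinarith

/-- The transform at 2πn is at most a constant times e^{-2πn/√N}, precisely the weight of the
expansion of f at height 1/√N. -/
theorem lSeriesDefined_testFunction {f : ℍ → ℂ}
    (hd : DifferentiableOn ℂ (f ∘ UpperHalfPlane.ofComplex) {z : ℂ | 0 < z.im})
    (hp : ∀ z, f (UpperHalfPlane.ofComplex (z + 1)) = f (UpperHalfPlane.ofComplex z)) (s : ℂ) :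
    LSeriesDefined f (testFunction N s 0) := by
  obtain ⟨k, hk⟩ := exists_nat_gt s.re
  have ha := one_div_pos.2 (sqrt_level_pos N)
  refine ⟨fun n hn _ => Or.inr ⟨_, isLaplaceContinuation_testFunction hk
    (two_pi_mul_intCast_ne_zero hn)⟩, ?_⟩
  obtain ⟨B, hB⟩ := exists_norm_oscExtension_le k (M := ‖s‖) hk (mul_pos Real.two_pi_pos ha)
  refine Summable.of_norm_bounded (((summable_expansionCoeff_mul_exp hd hp ha).subtype _).mul_right B)
    fun n => ?_
  rw [laplace_testFunction hk (two_pi_mul_intCast_ne_zero n.2), norm_mul, norm_mul, norm_mul,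
    norm_neg, norm_I, one_mul, norm_exp, neg_re, ofReal_re]
  have h := hB s _ le_rfl le_rfl (by simp) (two_pi_mul_le_norm ha n.2)
  rw [← mul_assoc]
  exact mul_le_mul_of_nonneg_left h (by positivity)

/-- The quotient `(Λ(f, s) - Λ(f, 1)) / (s - 1)`, as a series. -/
def centralSlope (N : ℕ) (f : ℍ → ℂ) (s : ℂ) : ℂ :=
  ∑' n : {n : ℤ // n ≠ 0}, expansionCoeff f n *
    (-I * cexp (-(2 * Real.pi * (n : ℤ) * (1 / √(N : ℝ)) : ℝ)) *
      oscExtension 1 (s - 1) ((2 * Real.pi * (n : ℤ) * (1 / √(N : ℝ)) : ℝ)) /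
        ((2 * Real.pi * (n : ℤ) * (1 / √(N : ℝ)) : ℝ)))

theorem exists_norm_centralSlope_term_le {f : ℍ → ℂ}
    (hd : DifferentiableOn ℂ (f ∘ UpperHalfPlane.ofComplex) {z : ℂ | 0 < z.im})
    (hp : ∀ z, f (UpperHalfPlane.ofComplex (z + 1)) = f (UpperHalfPlane.ofComplex z)) :
    ∃ u : {n : ℤ // n ≠ 0} → ℝ, Summable u ∧
      ∀ (n : {n : ℤ // n ≠ 0}) (s : ℂ), s ∈ Metric.ball (1 : ℂ) (1 / 2) →
        ‖expansionCoeff f n * (-I * cexp (-(2 * Real.pi * (n : ℤ) * (1 / √(N : ℝ)) : ℝ)) *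
          oscExtension 1 (s - 1) ((2 * Real.pi * (n : ℤ) * (1 / √(N : ℝ)) : ℝ)) /
            ((2 * Real.pi * (n : ℤ) * (1 / √(N : ℝ)) : ℝ)))‖ ≤ u n := by
  have ha := one_div_pos.2 (sqrt_level_pos N)
  set a : ℝ := 1 / √(N : ℝ)
  have hc := mul_pos Real.two_pi_pos ha
  obtain ⟨B, hB⟩ := exists_norm_oscExtension_le 1 (M := 1 / 2) (r := 1 / 2) (by norm_num) hc
  refine ⟨_, ((summable_expansionCoeff_mul_exp hd hp ha).subtype _).mul_right
    (B / (2 * Real.pi * a)), fun n s hs => ?_⟩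
  rw [mem_ball_iff_norm] at hs
  have h := hB (s - 1) _ ((re_le_norm _).trans hs.le) hs.le (by simp) (two_pi_mul_le_norm ha n.2)
  have hB0 := (norm_nonneg _).trans h
  rw [norm_mul, norm_div, norm_mul, norm_mul, norm_neg, norm_I, one_mul, norm_exp, neg_re,
    ofReal_re, mul_div_assoc, ← mul_assoc]
  refine mul_le_mul_of_nonneg_left ?_ (by positivity)
  exact div_le_div₀ hB0 h hc (two_pi_mul_le_norm ha n.2)

theorem continuousAt_centralSlope {f : ℍ → ℂ}
    (hd : DifferentiableOn ℂ (f ∘ UpperHalfPlane.ofComplex) {z : ℂ | 0 < z.im})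
    (hp : ∀ z, f (UpperHalfPlane.ofComplex (z + 1)) = f (UpperHalfPlane.ofComplex z)) :
    ContinuousAt (centralSlope N f) 1 := by
  obtain ⟨u, hu, hb⟩ := exists_norm_centralSlope_term_le (N := N) hd hp
  have ha := one_div_pos.2 (sqrt_level_pos N)
  refine ContinuousOn.continuousAt (continuousOn_tsum (fun n => ?_) hu hb)
    (Metric.ball_mem_nhds _ one_half_pos)
  have h : ContinuousOn (fun s : ℂ =>
      oscExtension 1 (s - 1) ((2 * Real.pi * (n : ℤ) * (1 / √(N : ℝ)) : ℝ)))
      (Metric.ball (1 : ℂ) (1 / 2)) := by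
    refine (continuousOn_oscExtension 1).comp (f := fun s : ℂ =>
      (s - 1, ((2 * Real.pi * (n : ℤ) * (1 / √(N : ℝ)) : ℝ) : ℂ))) (by fun_prop) fun s hs => ?_
    rw [mem_ball_iff_norm] at hs
    have h1 := re_le_norm (s - 1)
    refine ⟨?_, by simp only [ofReal_im, le_refl], ?_⟩
    · simp only [Nat.cast_one]
      linarith
    · exact ofReal_ne_zero.2 (mul_ne_zero (two_pi_mul_intCast_ne_zero n.2) ha.ne')
  exact continuousOn_const.mul ((continuousOn_const.mul h).div_const _)

theorem centralLambda_eq_add {f : ℍ → ℂ}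
    (hd : DifferentiableOn ℂ (f ∘ UpperHalfPlane.ofComplex) {z : ℂ | 0 < z.im})
    (hp : ∀ z, f (UpperHalfPlane.ofComplex (z + 1)) = f (UpperHalfPlane.ofComplex z))
    {s : ℂ} (hs : s ∈ Metric.ball (1 : ℂ) (1 / 2)) :
    centralLambda N f s = centralLambda N f 1 + (s - 1) * centralSlope N f s := by
  obtain ⟨u, hu, hb⟩ := exists_norm_centralSlope_term_le (N := N) hd hp
  have hs1 := (lSeriesDefined_testFunction (N := N) hd hp 1).2
  have hs2 := Summable.of_norm_bounded hu fun n => hb n s hs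
  rw [centralLambda, centralLambda, lSeries, lSeries, centralSlope, ← tsum_mul_left,
    ← hs1.tsum_add (hs2.mul_left _)]
  refine tsum_congr fun n => ?_
  rw [mem_ball_iff_norm] at hs
  have h1 := re_le_norm (s - 1)
  rw [sub_re, one_re] at h1
  -- With re s < 3/2, k = 2 suffices; one unfolding of the recursion exposes the factor s - 1, which
  -- vanishes at s = 1.
  rw [laplace_testFunction (k := 2) (by push_cast; linarith) (two_pi_mul_intCast_ne_zero n.2),
    laplace_testFunction (k := 2) (by simp) (two_pi_mul_intCast_ne_zero n.2),
    oscExtension_succ 1 s, oscExtension_succ 1 1, sub_self]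
  ring

/-- Off s = 1 the slope equals `centralSlope`, so its continuity at 1 suffices and no termwise
derivative in s is required. -/
theorem hasDerivAt_centralLambda {f : ℍ → ℂ}
    (hd : DifferentiableOn ℂ (f ∘ UpperHalfPlane.ofComplex) {z : ℂ | 0 < z.im})
    (hp : ∀ z, f (UpperHalfPlane.ofComplex (z + 1)) = f (UpperHalfPlane.ofComplex z)) :
    HasDerivAt (centralLambda N f) (centralSlope N f 1) 1 := by
  rw [hasDerivAt_iff_tendsto_slope]
  refine ((continuousAt_centralSlope hd hp).tendsto.mono_left nhdsWithin_le_nhds).congr' ?_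
  filter_upwards [nhdsWithin_le_nhds (Metric.ball_mem_nhds (1 : ℂ) one_half_pos),
    self_mem_nhdsWithin] with s hs hs1
  have hs1' : s - 1 ≠ 0 := sub_ne_zero.2 hs1
  rw [slope_def_field, centralLambda_eq_add hd hp hs, add_sub_cancel_left,
    mul_div_cancel_left₀ _ hs1']

theorem centralSlope_one {f : ℍ → ℂ}
    (hd : DifferentiableOn ℂ (f ∘ UpperHalfPlane.ofComplex) {z : ℂ | 0 < z.im})
    (hp : ∀ z, f (UpperHalfPlane.ofComplex (z + 1)) = f (UpperHalfPlane.ofComplex z))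
    (h0 : expansionCoeff f 0 = 0) :
    centralSlope N f 1 = ((√(N : ℝ) : ℝ) : ℂ) * I *
      ∫ x in (0 : ℝ)..1, f (UpperHalfPlane.ofComplex (x + (1 / √(N : ℝ) : ℝ) * I)) *
        (log (Gamma (x + (1 / √(N : ℝ) : ℝ) * I)) +
          (((Real.log (√(N : ℝ)) : ℝ) : ℂ) - Real.pi * I / 2) *
            (x + (1 / √(N : ℝ) : ℝ) * I)) := by
  have hN := sqrt_level_pos N
  have ha := one_div_pos.2 hN
  -- Height at most 1 keeps the segment in the region where the branch of log Γ is controlled.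
  have ha1 : 1 / √(N : ℝ) ≤ 1 := by
    rw [div_le_one hN, Real.one_le_sqrt]
    exact_mod_cast NeZero.one_le
  have hC : log ((1 / √(N : ℝ) : ℝ) * I) +
      (((Real.log (√(N : ℝ)) : ℝ) : ℂ) - Real.pi * I / 2) = 0 := by
    rw [log_ofReal_mul ha I_ne_zero, log_I, one_div, Real.log_inv]
    push_cast
    ring
  have haN : ((√(N : ℝ) : ℝ) : ℂ) * ((1 / √(N : ℝ) : ℝ) : ℂ) = 1 := by
    rw [← ofReal_mul, mul_one_div_cancel hN.ne', ofReal_one]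
  set a : ℝ := 1 / √(N : ℝ) with ha_def
  set C : ℂ := ((Real.log (√(N : ℝ)) : ℝ) : ℂ) - Real.pi * I / 2
  have hg : ContinuousOn (fun x : ℝ => log (Gamma (x + a * I)) + C * (x + a * I)) (Icc 0 1) :=
    (continuousOn_log_Gamma_segment ha ha1).add (by fun_prop)
  have h := hasSum_integral_mul_expansion hd hp ha hg
  rw [← h.tsum_eq, ← tsum_subtype_eq_of_support_subset (s := {n : ℤ | n ≠ 0}), centralSlope,
    ← tsum_mul_left]
  · refine tsum_congr fun n => ?_
    have h1 : cexp (I * (2 * Real.pi * (n : ℤ) : ℝ)) = 1 := by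
      rw [exp_eq_one_iff]
      exact ⟨n, by push_cast; ring⟩
    have hq : ((2 * Real.pi * (n : ℤ) * a : ℝ) : ℂ) ≠ 0 :=
      ofReal_ne_zero.2 (mul_ne_zero (two_pi_mul_intCast_ne_zero n.2) ha.ne')
    rw [integral_exp_mul_log_Gamma_add ha ha1 (two_pi_mul_intCast_ne_zero n.2) h1 hC, sub_self,
      ← ha_def]
    have h2 : (-(2 * Real.pi * (n : ℤ) * a) : ℂ) = -((2 * Real.pi * (n : ℤ) * a : ℝ) : ℂ) := by
      push_cast
      ring
    rw [h2]
    set q : ℂ := ((2 * Real.pi * (n : ℤ) * a : ℝ) : ℂ)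
    linear_combination (expansionCoeff f n * I * cexp (-q) * oscExtension 1 0 q / q) * haN
  -- The term n = 0, to which the formula for the coefficients does not apply, drops out because the
  -- constant term of f vanishes.
  · intro n hn h
    rw [Function.mem_support] at hn
    subst h
    exact hn (by rw [h0, zero_mul, zero_mul])

end CentralDerivative

end

theorem mainTheorem4 (N : ℕ) [NeZero N] (f : ℍ → ℂ)
    (hf : IsWeaklyHolomorphicCuspForm N 2 f)
    (hW : f ∣[(2 : ℤ)] (frickeMatrix N : GL (Fin 2) ℝ) = f) :
    (∀ s : ℂ, LSeriesDefined f (testFunction N s 0)) ∧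
    HasDerivAt (centralLambda N f)
      (((√(N : ℝ) : ℝ) : ℂ) * Complex.I *
        ∫ x in (0 : ℝ)..1,
          f (UpperHalfPlane.ofComplex (Complex.I / ((√(N : ℝ) : ℝ) : ℂ) + x)) *
            (Complex.log (Complex.Gamma (Complex.I / ((√(N : ℝ) : ℝ) : ℂ) + x)) +
              (((Real.log (√(N : ℝ)) : ℝ) : ℂ) - Real.pi * Complex.I / 2) *
                (Complex.I / ((√(N : ℝ) : ℝ) : ℂ) + x)))
      1 := by
  have hd := hf.holomorphic
  have hp := hf.comp_ofComplex_add_one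
  refine ⟨lSeriesDefined_testFunction hd hp, ?_⟩
  have h := hasDerivAt_centralLambda (N := N) hd hp
  rw [centralSlope_one hd hp hf.coeff_zero] at h
  have hz : ∀ x : ℝ, Complex.I / ((√(N : ℝ) : ℝ) : ℂ) + x =
      x + (1 / √(N : ℝ) : ℝ) * Complex.I := fun x => by
    push_cast
    ring
  simp only [hz]
  exact h
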